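/- **Theorem (non-parametric upper bound for the TAB $K$-NN classifier, general case).** *Setting.* Let $d\ge 1$ and let $Q$ (target) and $P$ (source) be probability distributions on $\mathbb R^d\times\{0,1\}$ with feature marginals $Q_X,P_X$, supports $\Omega=\mathrm{supp}\,Q_X$, $\Omega_P=\mathrm{supp}\,P_X$, and regression functions $\eta^Q(x)=Q(Y=1\mid X=x)$, $\eta^P(x)=P(Y=1\mid X=x)$ (fixed measurable versions $\mathbb R^d\to[0,1]$). For a classifier $f$ put $\mathcal E_Q(f)=Q(Y\ne f(X))-Q(Y\neq \mathbf 1\{\eta^Q(X)\ge \tfrac12\})$. The signal strength of the source is $s(x)=\max\{\mathrm{sgn}(\eta^Q(x)-\frac12)(\eta^P(x)-\frac12),0\}$ for $x\in\Omega_P$ and $s(x)=0$ for $x\notin\Omega_P$ (where $P(Y=1\mid X=x)$ has no meaning). Let $B(x,r)$ be the closed Euclidean ball, $\lambda$ Lebesgue measure, $a\wedge b=\min(a,b)$, $a\vee b=\max(a,b)$. Fix $\alpha\ge0$, $C_\alpha,\gamma,C_\gamma>0$, $\beta,\beta_P\in[0,1]$, $C_\beta,C_{\beta_P}>0$, $\mu^+,\mu^-,c_\mu,r_\mu>0$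 and a function $\varepsilon$ that is continuous and nondecreasing on $[0,\frac12]$. The class $\Pi^{NP}$ consists of all pairs $(Q,P)$ (with their regression functions) such that * (margin) $Q_X(0<|\eta^Q(X)-\frac12|\le t)\le C_\alpha t^\alpha$ for all $t>0$; * (ambiguity level) $\mathbb E_Q\big[|\eta^Q(X)-\frac12|\,\mathbf 1\{s(X)\le C_\gamma|\eta^Q(X)-\frac12|^\gamma,\ |\eta^Q(X)-\frac12|\le z\}\big]\le\varepsilon(z)$ for all $z\in[0,\frac12]$; * (smoothness) $|\eta^Q(x)-\eta^Q(x')|\le C_\beta\|x-x'\|^\beta$ and $|\eta^P(x)-\eta^P(x')|\le C_{\beta_P}\|x-x'\|^{\beta_P}$ for all $x,x'\in\mathbb R^d$; * (strong density) $\nu\in\{Q_X,P_X\}$ has compact support $S$, is absolutely continuous, satisfies $\frac{d\nu}{d\lambda}\in[\mu^-,\mu^+]$ a.e. on $S$, and $\lambda(B(x,r)\cap S)/\lambda(B(x,r))\ge c_\mu$ for all $x\in S$, $0<r<r_\mu$. From independent i.i.d. samples $\mathcal D_Q\sim Q^{n_Q}$ and $\mathcal D_P\sim P^{n_P}$ form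 the $K$-NN averages $\hat\eta^Q_{k_Q}(x)$, $\hat\eta^P_{k_P}(x)$ of the labels of the $k_Q$ (resp. $k_P$) sample points nearest to $x$ in Euclidean distance (ties broken by index). The TAB $K$-NN classifier is $\hat f(x)=\mathbf 1\{\hat\eta^Q_{k_Q}(x)\ge\frac12\}$ if $|\hat\eta^Q_{k_Q}(x)-\frac12|\ge\tau$, and $\hat f(x)=\mathbf 1\{\hat\eta^P_{k_P}(x)\ge\frac12\}$ otherwise. Fix $c_Q,c_P>0$, let $k_Q=\lfloor c_Qn_Q^{2\beta/(2\beta+d)}\rfloor$, and write $\varepsilon(2\tau)$ for $\varepsilon(2\tau\wedge\frac12)$. *Asymptotic regime.* Let $K>0$ and $0<c_\tau\le C_\tau$ be arbitrary, and consider $n_Q,n_P,\tau$ with $$n_Q^{\frac d{2\beta+d}}\exp\!\big(-c_Qn_Q^{\frac{2\beta}{2\beta+d}}\big)\le K\,n_P^{-\frac{\beta(1+\alpha)}{2\gamma\beta+d}},\qquad c_\tau\log(n_Q\vee n_P)k_Q^{-1/2}\le\tau\le C_\tau\log(n_Q\vee n_P)k_Q^{-1/2}.\tag{1}$$ Below,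 $A\lesssim B$ means: there are $C>0$ and $N$, depending only on the fixed parameters ($d$, those of $\Pi^{NP}$, $c_Q,c_P$) and on $K,c_\tau,C_\tau$, such that $A\le CB$ for all $n_Q,n_P\ge N$ and $\tau$ satisfying (1) and for all $(Q,P)\in\Pi^{NP}$. *Conclusion.* In both cases below $\mathcal E_Q(\hat f)$ is an integrable function of the samples for such $n_Q,n_P,\tau$ and all $(Q,P)\in\Pi^{NP}$. (1) **Case $\gamma\beta\ge\beta_P$**, with $k_P=\lfloor c_Pn_P^{2\gamma\beta/(2\gamma\beta+d)}\rfloor$. There is a constant $c_b>0$, not depending on $K,c_\tau,C_\tau$, such that $$\mathbb E\,\mathcal E_Q(\hat f)\lesssim\Big(n_P^{-\frac{\beta(1+\alpha)}{2\gamma\beta+d}}+\varepsilon_b+\varepsilon(2\tau)\Big)\wedge\Big(\log^{1+\alpha}(n_Q\vee n_P)\,n_Q^{-\frac{\beta(1+\alpha)}{2\beta+d}}\Big) \lesssim\Big(n_P^{-\frac{\beta_P(1+\alpha)/\gamma}{2\gamma\beta+d}}+\varepsilon(2\tau)\Big)\wedge\Big(\log^{1+\alpha}(n_Q\vee n_P)\,n_Q^{-\frac{\beta(1+\alpha)}{2\beta+d}}\Big),$$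 where $\varepsilon_b=\int_{\Omega^b}|\eta^Q-\frac12|\,dQ_X$, $\Omega^+=\{x\in\Omega:s(x)\ge C_\gamma|\eta^Q(x)-\frac12|^\gamma\}$ and $$\Omega^b=\Big\{x\in\Omega:\ |\eta^Q(x)-\tfrac12|\le c_bn_P^{-\frac{\beta_P/\gamma}{2\gamma\beta+d}},\ \ B\big(x,c_bn_P^{-\frac1{2\gamma\beta+d}}\big)\cap\Omega_P\not\subset\Omega^+\Big\}.$$ (2) **Case $\gamma\beta<\beta_P$**, with instead $k_P=\lfloor c_Pn_P^{2\beta_P/(2\beta_P+d)}\rfloor$. Then $$\sup_{(Q,P)\in\Pi^{NP}}\mathbb E\,\mathcal E_Q(\hat f)\lesssim\Big(n_P^{-\frac{\beta_P(1+\alpha)/\gamma}{2\beta_P+d}}+\varepsilon(2\tau)\Big)\wedge\Big(\log^{1+\alpha}(n_Q\vee n_P)\,n_Q^{-\frac{\beta(1+\alpha)}{2\beta+d}}\Big).$$ -/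

import Mathlib

open MeasureTheory Set

noncomputable section

namespace TransferKNN

/-- Feature space with its Euclidean norm. -/
abbrev E (d : ℕ) : Type := EuclideanSpace ℝ (Fin d)

/-- A labelled observation; the label `true` stands for `1` and `false` for `0`. -/
abbrev Obs (d : ℕ) : Type := E d × Bool

/-- The numerical value in `{0, 1}` of a label. -/
def labelValue (y : Bool) : ℝ := if y then 1 else 0

/-- The marginal distribution of the feature. -/
def marginal {d : ℕ} (Q : Measure (Obs d)) : Measure (E d) := Q.map Prod.fst

/-- The support of the marginal distribution of the feature. -/
def featureSupport {d : ℕ} (Q : Measure (Obs d)) : Set (E d) := (marginal Q).support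

/-- `η` is a version of the regression function `x ↦ Q(Y = 1 | X = x)`. -/
structure IsRegressionFunction {d : ℕ} (Q : Measure (Obs d)) (η : E d → ℝ) : Prop where
  measurable : Measurable η
  mem_Icc : ∀ x, η x ∈ Icc (0 : ℝ) 1
  setIntegral_eq : ∀ A : Set (E d), MeasurableSet A →
    ∫ x in A, η x ∂(marginal Q) = Q.real (A ×ˢ {true})

/-- The Bayes classifier `1{η ≥ 1/2}`; more generally the plug-in rule of `η`. -/
def plugIn {d : ℕ} (η : E d → ℝ) (x : E d) : Bool := decide (1 / 2 ≤ η x)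

/-- Misclassification rate `Q(Y ≠ f(X))`. -/
def misclassRate {d : ℕ} (Q : Measure (Obs d)) (f : E d → Bool) : ℝ :=
  Q.real {z | z.2 ≠ f z.1}

/-- Excess risk of `f` on `Q`, where `ηQ` is the regression function of `Q`. -/
def excessRisk {d : ℕ} (Q : Measure (Obs d)) (ηQ : E d → ℝ) (f : E d → Bool) : ℝ :=
  misclassRate Q f - misclassRate Q (plugIn ηQ)

/-- Margin assumption. -/
def Margin {d : ℕ} (QX : Measure (E d)) (ηQ : E d → ℝ) (α Cα : ℝ) : Prop :=
  ∀ t : ℝ, 0 < t → QX.real {x | 0 < |ηQ x - 1 / 2| ∧ |ηQ x - 1 / 2| ≤ t} ≤ Cα * t ^ α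

/-- Signal strength of `ηP` relative to `ηQ`. The value `P(Y = 1 | X = x)` has a meaning only on
the support `ΩP` of the source; a point outside `ΩP` gets no signal from the source. -/
def signalStrength {d : ℕ} (ΩP : Set (E d)) (ηQ ηP : E d → ℝ) : E d → ℝ :=
  ΩP.indicator fun x => max (Real.sign (ηQ x - 1 / 2) * (ηP x - 1 / 2)) 0

/-- `ε` is an ambiguity level on `[0, 1/2]` for the pair, with parameters `γ, Cγ`. -/
structure AmbiguityLevel {d : ℕ} (QX : Measure (E d)) (ΩP : Set (E d)) (ηQ ηP : E d → ℝ)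
    (γ Cγ : ℝ) (ε : ℝ → ℝ) : Prop where
  continuousOn : ContinuousOn ε (Icc 0 (1 / 2))
  monotoneOn : MonotoneOn ε (Icc 0 (1 / 2))
  bound : ∀ z ∈ Icc (0 : ℝ) (1 / 2),
    ∫ x in {x | signalStrength ΩP ηQ ηP x ≤ Cγ * |ηQ x - 1 / 2| ^ γ ∧ |ηQ x - 1 / 2| ≤ z},
      |ηQ x - 1 / 2| ∂QX ≤ ε z

/-- The Hölder class on the whole space. -/
def HolderClass {d : ℕ} (β C : ℝ) (g : E d → ℝ) : Prop :=
  ∀ x x' : E d, |g x - g x'| ≤ C * ‖x - x'‖ ^ β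

/-- Strong density condition with parameters `(μ⁺, μ⁻, c_μ, r_μ)`. -/
structure StrongDensity {d : ℕ} (ν : Measure (E d)) (μp μm cμ rμ : ℝ) : Prop where
  isCompact_support : IsCompact ν.support
  absolutelyContinuous : ν ≪ volume
  density : ∀ᵐ x ∂((volume : Measure (E d)).restrict ν.support),
    ν.rnDeriv volume x ∈ Icc (ENNReal.ofReal μm) (ENNReal.ofReal μp)
  regular : ∀ x ∈ ν.support, ∀ r : ℝ, 0 < r → r < rμ →
    cμ ≤ (volume : Measure (E d)).real (Metric.closedBall x r ∩ ν.support) /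
      (volume : Measure (E d)).real (Metric.closedBall x r)

/-- The numerical parameters of the nonparametric class. -/
structure Params where
  (α Cα γ Cγ β βP Cβ CβP μp μm cμ rμ : ℝ)
  α_nonneg : 0 ≤ α
  Cα_pos : 0 < Cα
  γ_pos : 0 < γ
  Cγ_pos : 0 < Cγ
  β_mem : β ∈ Icc (0 : ℝ) 1
  βP_mem : βP ∈ Icc (0 : ℝ) 1
  Cβ_pos : 0 < Cβ
  CβP_pos : 0 < CβP
  μp_pos : 0 < μp
  μm_pos : 0 < μm
  cμ_pos : 0 < cμ
  rμ_pos : 0 < rμ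

/-- `(Q, P)` belongs to the nonparametric class, with regression functions `ηQ`, `ηP`. -/
structure NPClass {d : ℕ} (p : Params) (ε : ℝ → ℝ) (Q P : Measure (Obs d))
    (ηQ ηP : E d → ℝ) : Prop where
  probQ : IsProbabilityMeasure Q
  probP : IsProbabilityMeasure P
  regQ : IsRegressionFunction Q ηQ
  regP : IsRegressionFunction P ηP
  margin : Margin (marginal Q) ηQ p.α p.Cα
  ambiguity : AmbiguityLevel (marginal Q) (featureSupport P) ηQ ηP p.γ p.Cγ ε
  holderQ : HolderClass p.β p.Cβ ηQ
  holderP : HolderClass p.βP p.CβP ηP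
  densityQ : StrongDensity (marginal Q) p.μp p.μm p.cμ p.rμ
  densityP : StrongDensity (marginal P) p.μp p.μm p.cμ p.rμ

/-- `K`-nearest-neighbour regression estimate: the average label of the `k` sample points that are
closest to `x`. `Tuple.sort` lists the indices by increasing distance, ties broken by index. -/
def knnEstimate {d n : ℕ} (D : Fin n → Obs d) (k : ℕ) (x : E d) : ℝ :=
  (k : ℝ)⁻¹ * ∑ i ∈ Finset.univ.filter (fun i : Fin n => (i : ℕ) < k),
    labelValue (D (Tuple.sort (fun j => dist (D j).1 x) i)).2

/-- The TAB `K`-NN classifier with threshold `τ`. -/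
def tabKNN {d nQ nP : ℕ} (kQ kP : ℕ) (τ : ℝ) (DQ : Fin nQ → Obs d) (DP : Fin nP → Obs d)
    (x : E d) : Bool :=
  if τ ≤ |knnEstimate DQ kQ x - 1 / 2| then plugIn (knnEstimate DQ kQ) x
  else plugIn (knnEstimate DP kP) x

/-- Joint law of the two independent i.i.d. samples. -/
def sampleLaw {d : ℕ} (Q P : Measure (Obs d)) (nQ nP : ℕ) :
    Measure ((Fin nQ → Obs d) × (Fin nP → Obs d)) :=
  (Measure.pi fun _ => Q).prod (Measure.pi fun _ => P)

/-- Excess risk of the TAB `K`-NN classifier as a function of the two samples. -/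
def tabExcessRisk {d : ℕ} (Q : Measure (Obs d)) (ηQ : E d → ℝ) {nQ nP : ℕ} (kQ kP : ℕ) (τ : ℝ)
    (D : (Fin nQ → Obs d) × (Fin nP → Obs d)) : ℝ :=
  excessRisk Q ηQ (tabKNN kQ kP τ D.1 D.2)

/-- Expected excess risk of the TAB `K`-NN classifier. -/
def expectedTabRisk {d : ℕ} (Q P : Measure (Obs d)) (ηQ : E d → ℝ) (nQ nP kQ kP : ℕ) (τ : ℝ) :
    ℝ :=
  ∫ D, tabExcessRisk Q ηQ kQ kP τ D ∂(sampleLaw Q P nQ nP)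

/-- The region `Ω⁺(γ, Cγ)` of `Ω` with strong signal. -/
def strongSignal {d : ℕ} (Ω ΩP : Set (E d)) (ηQ ηP : E d → ℝ) (γ Cγ : ℝ) : Set (E d) :=
  {x ∈ Ω | Cγ * |ηQ x - 1 / 2| ^ γ ≤ signalStrength ΩP ηQ ηP x}

/-- The boundary `Ω^b` of the signal transfer set, with constant `cb` and source size `nP`. -/
def boundarySet {d : ℕ} (p : Params) (Ω ΩP : Set (E d)) (ηQ ηP : E d → ℝ) (cb : ℝ) (nP : ℕ) :
    Set (E d) :=
  {x ∈ Ω | |ηQ x - 1 / 2| ≤ cb * (nP : ℝ) ^ (-(p.βP / p.γ / (2 * p.γ * p.β + d))) ∧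
    ¬ Metric.closedBall x (cb * (nP : ℝ) ^ (-(1 / (2 * p.γ * p.β + d)))) ∩ ΩP ⊆
      strongSignal Ω ΩP ηQ ηP p.γ p.Cγ}

/-- The boundary risk `ε_b`. -/
def boundaryRisk {d : ℕ} (p : Params) (Q P : Measure (Obs d)) (ηQ ηP : E d → ℝ) (cb : ℝ)
    (nP : ℕ) : ℝ :=
  ∫ x in boundarySet p (featureSupport Q) (featureSupport P) ηQ ηP cb nP,
    |ηQ x - 1 / 2| ∂(marginal Q)

/-- Number of neighbours `⌊c n^{2b/(2b+d)}⌋` for the smoothness index `b`. -/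
def numNeighbors (d : ℕ) (c b : ℝ) (n : ℕ) : ℕ := ⌊c * (n : ℝ) ^ (2 * b / (2 * b + d))⌋₊

/-- `n_Q^{d/(2β+d)} exp(-c_Q n_Q^{2β/(2β+d)}) ≤ K n_P^{-β(1+α)/(2γβ+d)}`. -/
def SampleSizeCondition (d : ℕ) (p : Params) (cQ K : ℝ) (nQ nP : ℕ) : Prop :=
  (nQ : ℝ) ^ ((d : ℝ) / (2 * p.β + d)) * Real.exp (-(cQ * (nQ : ℝ) ^ (2 * p.β / (2 * p.β + d)))) ≤
    K * (nP : ℝ) ^ (-(p.β * (1 + p.α) / (2 * p.γ * p.β + d)))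

/-- `log(n_Q ∨ n_P) k^{-1/2}`, the order of magnitude of the threshold. -/
def thresholdScale (nQ nP k : ℕ) : ℝ :=
  Real.log (max (nQ : ℝ) (nP : ℝ)) * (k : ℝ) ^ (-(1 / 2 : ℝ))

/-- The rate `log^{1+α}(n_Q ∨ n_P) n_Q^{-β(1+α)/(2β+d)}`. -/
def targetRate (d : ℕ) (p : Params) (nQ nP : ℕ) : ℝ :=
  Real.log (max (nQ : ℝ) (nP : ℝ)) ^ (1 + p.α) *
    (nQ : ℝ) ^ (-(p.β * (1 + p.α) / (2 * p.β + d)))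

/-- `ε(2τ)`, where `ε` is given on `[0, 1/2]` and `|η - 1/2| ≤ 1/2` always holds. -/
def ambiguityAt (ε : ℝ → ℝ) (τ : ℝ) : ℝ := ε (min (2 * τ) (1 / 2))

end TransferKNN

end

/-! The excess risk is the mean of `2 * |ηQ - 1/2|` over the region where the rule differs from the
Bayes rule, so by Fubini it suffices to bound the error probability at each `x`. If the target
estimate is within `τ` of `ηQ x`, an error can occur only when `|ηQ x - 1/2| < 2τ` and the source
vote is wrong (`tabKNN_ne_imp`).

Both estimates are controlled by `knnEstimate_tail`. Strong density puts all `k` neighbours within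
`A n^{-1/(2b+d)}` up to probability `exp(-Mk)`, and given the features the labels are independent,
so Hoeffding applies. For the target, `τ` exceeds bias and noise by a logarithm, and (1) makes the
remaining exponential probability negligible on the scale of `n_P`. Bounding the source error by 1
on `|ηQ - 1/2| ≤ 2τ`, the margin condition then gives the target rate.

For the source bound, the ambiguous part of that region costs `ε(2τ)`. Elsewhere the signal at `x`
exceeds `Cγ ζ^γ`, with `ζ = |ηQ x - 1/2|`. If it persists at the neighbours up to a constant, the
source errs with probability about `exp(-c (ζ/h)^{2γ})`, where `h = n_P^{-b/(γ(2b+d))}`, and peeling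
with the margin condition integrates this to order `h^{1+α}`. Persistence follows from smoothness of
`ηP` once `ζ^γ` dominates its bias; for `b = β_P` this holds as soon as `ζ` is of order `h`. For `b
= γβ` the bias may be larger: either all neighbours lie in `Ω⁺` and smoothness of `ηQ` transfers
their signal to `x`, or `ζ` is large, or `x` lies in `Ω^b`, which costs `ε_b`. -/

namespace TransferKNN

variable {d : ℕ}

/-! ### Measurability of the classifier jointly in the samples and the query point. -/

lemma measurable_labelValue : Measurable labelValue := measurable_of_countable _

/-- Breaking ties by index makes the sorting permutation unique, hence characterised by finitely
many comparisons of measurable functions. -/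
lemma measurableSet_sort_eq {n : ℕ} {X : Type*} [MeasurableSpace X] {f : X → Fin n → ℝ}
    (hf : ∀ i, Measurable fun x => f x i) (σ : Equiv.Perm (Fin n)) :
    MeasurableSet {x | Tuple.sort (f x) = σ} := by
  have : {x | Tuple.sort (f x) = σ} =
      (⋂ i, ⋂ j, {x | i ≤ j → f x (σ i) ≤ f x (σ j)}) ∩
      ⋂ i, ⋂ j, {x | i < j → f x (σ i) = f x (σ j) → σ i < σ j} := by
    ext x
    rw [mem_ofPred_eq, eq_comm, Tuple.eq_sort_iff]
    simp [Monotone]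
  rw [this]
  refine (MeasurableSet.iInter fun i => .iInter fun j => ?_).inter
    (MeasurableSet.iInter fun i => .iInter fun j => ?_)
  · by_cases h : i ≤ j
    · simpa [h] using measurableSet_le (hf _) (hf _)
    · simp [h]
  · by_cases h : i < j
    · by_cases h' : σ i < σ j
      · simp [h']
      · simp only [h, h', true_imp_iff, imp_false]
        exact (measurableSet_eq_fun (hf (σ i)) (hf (σ j))).compl
    · simp [h]

lemma measurable_sort_apply {n : ℕ} {X : Type*} [MeasurableSpace X] {f : X → Fin n → ℝ}
    (hf : ∀ i, Measurable fun x => f x i) (i : Fin n) :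
    Measurable fun x => Tuple.sort (f x) i := by
  refine measurable_to_countable' fun j => ?_
  have : (fun x => Tuple.sort (f x) i) ⁻¹' {j} =
      ⋃ σ : Equiv.Perm (Fin n), ⋃ _ : σ i = j, {x | Tuple.sort (f x) = σ} := by
    ext x; simp
  rw [this]
  exact MeasurableSet.iUnion fun σ => .iUnion fun _ => measurableSet_sort_eq hf σ

lemma measurable_knnEstimate {n : ℕ} (k : ℕ) :
    Measurable fun z : (Fin n → Obs d) × E d => knnEstimate z.1 k z.2 := by
  unfold knnEstimate
  refine Measurable.const_mul (Finset.measurable_sum _ fun i _ => ?_) _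
  refine measurable_labelValue.comp
    ((measurable_snd : Measurable (Prod.snd : Obs d → Bool)).comp ?_)
  have h1 : Measurable fun z : (Fin n → Obs d) × E d =>
      Tuple.sort (fun j => dist (z.1 j).1 z.2) i :=
    measurable_sort_apply (f := fun z : (Fin n → Obs d) × E d => fun j => dist (z.1 j).1 z.2)
      (fun j => by fun_prop) i
  have h2 : Measurable fun w : (Fin n → Obs d) × Fin n => w.1 w.2 :=
    measurable_from_prod_countable_left fun j => measurable_pi_apply j
  exact h2.comp (measurable_fst.prodMk h1)

lemma measurable_plugIn_comp {X : Type*} [MeasurableSpace X] {g : X → ℝ} (hg : Measurable g) :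
    Measurable fun x => (decide (1 / 2 ≤ g x)) :=
  measurable_to_bool (by
    simpa [preimage, -one_div] using measurableSet_le measurable_const hg)

lemma measurable_plugIn {η : E d → ℝ} (hη : Measurable η) : Measurable (plugIn η) :=
  measurable_plugIn_comp hη

lemma measurable_tabKNN {nQ nP : ℕ} (kQ kP : ℕ) (τ : ℝ) :
    Measurable fun z : ((Fin nQ → Obs d) × (Fin nP → Obs d)) × E d =>
      tabKNN kQ kP τ z.1.1 z.1.2 z.2 := by
  have hQ : Measurable fun z : ((Fin nQ → Obs d) × (Fin nP → Obs d)) × E d =>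
      knnEstimate z.1.1 kQ z.2 :=
    (measurable_knnEstimate kQ).comp
      ((measurable_fst.comp measurable_fst).prodMk measurable_snd)
  have hP : Measurable fun z : ((Fin nQ → Obs d) × (Fin nP → Obs d)) × E d =>
      knnEstimate z.1.2 kP z.2 :=
    (measurable_knnEstimate kP).comp
      ((measurable_snd.comp measurable_fst).prodMk measurable_snd)
  unfold tabKNN plugIn
  exact Measurable.ite (measurableSet_le measurable_const (hQ.sub_const _).abs)
    (measurable_plugIn_comp hQ) (measurable_plugIn_comp hP)

instance (Q : Measure (Obs d)) [IsProbabilityMeasure Q] : IsProbabilityMeasure (marginal Q) :=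
  Measure.isProbabilityMeasure_map measurable_fst.aemeasurable

instance (Q P : Measure (Obs d)) [IsProbabilityMeasure Q] [IsProbabilityMeasure P] (nQ nP : ℕ) :
    IsProbabilityMeasure (sampleLaw Q P nQ nP) := by
  unfold sampleLaw; infer_instance

/-! ### The excess risk as an integral over the feature space. -/

lemma IsRegressionFunction.integrable {Q : Measure (Obs d)} [IsProbabilityMeasure Q]
    {η : E d → ℝ} (h : IsRegressionFunction Q η) : Integrable η (marginal Q) :=
  Integrable.of_mem_Icc 0 1 h.measurable.aemeasurable (ae_of_all _ h.mem_Icc)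

/-- Splitting the error event by the label leaves only rectangles, on which the defining identity of
the regression function suffices; no disintegration of `Q` is needed. -/
lemma misclassRate_eq {Q : Measure (Obs d)} [IsProbabilityMeasure Q] {η : E d → ℝ}
    (h : IsRegressionFunction Q η) {f : E d → Bool} (hf : Measurable f) :
    misclassRate Q f = ∫ x, (if f x then 1 - η x else η x) ∂(marginal Q) := by
  set A : Set (E d) := f ⁻¹' {true} with hA
  have hAm : MeasurableSet A := hf (measurableSet_singleton _)
  have hset : {z : Obs d | z.2 ≠ f z.1} = (Aᶜ ×ˢ {true}) ∪ (A ×ˢ {false}) := by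
    ext ⟨x, y⟩
    rcases y <;> rcases hfx : f x <;> simp [hA, hfx]
  have hdisj : Disjoint (Aᶜ ×ˢ ({true} : Set Bool)) (A ×ˢ {false}) := by
    rw [Set.disjoint_left]
    rintro ⟨x, y⟩ h1 h2
    exact h1.1 h2.1
  have hm : ∀ B : Set (E d), MeasurableSet B → ∀ b : Bool, MeasurableSet (B ×ˢ ({b} : Set Bool)) :=
    fun B hB b => hB.prod (measurableSet_singleton _)
  have hfalse : Q.real (A ×ˢ {false}) = ∫ x in A, (1 - η x) ∂(marginal Q) := by
    have h1 : (marginal Q).real A = Q.real (A ×ˢ {true}) + Q.real (A ×ˢ {false}) := by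
      rw [← measureReal_union (by
        rw [Set.disjoint_left]; rintro ⟨x, y⟩ h1 h2; exact absurd (h1.2.symm.trans h2.2) (by simp)) (hm A hAm false)]
      rw [marginal, map_measureReal_apply measurable_fst hAm]
      congr 1
      ext ⟨x, y⟩
      rcases y <;> simp
    rw [integral_sub (integrable_const _) h.integrable.integrableOn, h.setIntegral_eq A hAm]
    rw [setIntegral_const, smul_eq_mul, mul_one]
    linarith
  rw [misclassRate, hset, measureReal_union hdisj (hm A hAm false), hfalse,
    ← h.setIntegral_eq _ hAm.compl, add_comm]
  have hint : Integrable (fun x => if f x then 1 - η x else η x) (marginal Q) := by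
    refine Integrable.of_mem_Icc 0 1 (Measurable.ite hAm ?_ h.measurable).aemeasurable
      (ae_of_all _ fun x => ?_)
    · exact measurable_const.sub h.measurable
    · have := h.mem_Icc x
      split_ifs <;> constructor <;> linarith [this.1, this.2]
  rw [← integral_add_compl hAm hint]
  congr 1
  · refine setIntegral_congr_fun hAm fun x hx => ?_
    have : f x = true := hx
    simp [this]
  · refine setIntegral_congr_fun hAm.compl fun x hx => ?_
    have : ¬ f x = true := hx
    simp [this]

/-- The excess risk is twice the integral of the margin over the set of disagreement with the
Bayes classifier. -/
lemma excessRisk_eq {Q : Measure (Obs d)} [IsProbabilityMeasure Q] {η : E d → ℝ}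
    (h : IsRegressionFunction Q η) {f : E d → Bool} (hf : Measurable f) :
    excessRisk Q η f =
      ∫ x, 2 * |η x - 1 / 2| * (if f x ≠ plugIn η x then 1 else 0) ∂(marginal Q) := by
  have hi : ∀ {g : E d → Bool}, Measurable g →
      Integrable (fun x => if g x then 1 - η x else η x) (marginal Q) := by
    intro g hg
    refine Integrable.of_mem_Icc 0 1 (Measurable.ite (hg (measurableSet_singleton true)) ?_
      h.measurable).aemeasurable (ae_of_all _ fun x => ?_)
    · exact measurable_const.sub h.measurable
    · have := h.mem_Icc x
      split_ifs <;> constructor <;> linarith [this.1, this.2]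
  rw [excessRisk, misclassRate_eq h hf, misclassRate_eq h (measurable_plugIn h.measurable),
    ← integral_sub (hi hf) (hi (measurable_plugIn h.measurable))]
  refine integral_congr_ae (ae_of_all _ fun x => ?_)
  by_cases hx : 1 / 2 ≤ η x
  · have hp : plugIn η x = true := by simp [plugIn]; linarith
    have ha : |η x - 1 / 2| = η x - 1 / 2 := abs_of_nonneg (by linarith)
    rcases hfx : f x
    all_goals simp only [hfx, hp, ha]; norm_num
    linarith
  · have hp : plugIn η x = false := by simp [plugIn]; linarith
    have ha : |η x - 1 / 2| = -(η x - 1 / 2) := abs_of_nonpos (by linarith)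
    rcases hfx : f x
    all_goals simp only [hfx, hp, ha]; norm_num
    linarith

/-! ### Exchanging the sample and feature expectations. -/

section Fubini

variable {Q P : Measure (Obs d)} [IsProbabilityMeasure Q] [IsProbabilityMeasure P] {ηQ : E d → ℝ}

lemma abs_sub_half_le {y : ℝ} (h : y ∈ Icc (0 : ℝ) 1) : |y - 1 / 2| ≤ 1 / 2 :=
  abs_le.2 ⟨by linarith [h.1], by linarith [h.2]⟩

lemma integrable_tab_integrand (h : IsRegressionFunction Q ηQ) (nQ nP kQ kP : ℕ) (τ : ℝ) :
    Integrable (fun z : ((Fin nQ → Obs d) × (Fin nP → Obs d)) × E d =>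
      2 * |ηQ z.2 - 1 / 2| * (if tabKNN kQ kP τ z.1.1 z.1.2 z.2 ≠ plugIn ηQ z.2 then (1 : ℝ) else 0))
      ((sampleLaw Q P nQ nP).prod (marginal Q)) := by
  have hm := h.measurable
  have hs : MeasurableSet {z : ((Fin nQ → Obs d) × (Fin nP → Obs d)) × E d |
      tabKNN kQ kP τ z.1.1 z.1.2 z.2 ≠ plugIn ηQ z.2} :=
    (measurableSet_eq_fun (measurable_tabKNN kQ kP τ)
      ((measurable_plugIn hm).comp measurable_snd)).compl
  refine Integrable.of_mem_Icc 0 1 (Measurable.aemeasurable ?_) (ae_of_all _ fun z => ?_)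
  · refine Measurable.mul (by fun_prop) (Measurable.ite hs measurable_const measurable_const)
  · have h1 := abs_sub_half_le (h.mem_Icc z.2)
    have h0 := abs_nonneg (ηQ z.2 - 1 / 2)
    split_ifs <;> constructor <;> linarith

lemma tabExcessRisk_eq (h : IsRegressionFunction Q ηQ) {nQ nP : ℕ} (kQ kP : ℕ) (τ : ℝ)
    (D : (Fin nQ → Obs d) × (Fin nP → Obs d)) :
    tabExcessRisk Q ηQ kQ kP τ D = ∫ x, 2 * |ηQ x - 1 / 2| *
      (if tabKNN kQ kP τ D.1 D.2 x ≠ plugIn ηQ x then 1 else 0) ∂(marginal Q) := by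
  have hx : Measurable fun x : E d => (D, x) := measurable_const.prodMk measurable_id
  have hf := (measurable_tabKNN (d := d) kQ kP τ).comp hx
  simp only [Function.comp_def] at hf
  exact excessRisk_eq h hf

lemma integrable_tabExcessRisk (h : IsRegressionFunction Q ηQ) (nQ nP kQ kP : ℕ) (τ : ℝ) :
    Integrable (tabExcessRisk Q ηQ kQ kP τ) (sampleLaw Q P nQ nP) := by
  refine (integrable_tab_integrand (P := P) h nQ nP kQ kP τ).integral_prod_left.congr
    (ae_of_all _ fun D => ?_)
  exact (tabExcessRisk_eq h kQ kP τ D).symm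

/-- Fubini: the expected excess risk in terms of the pointwise error probabilities. -/
lemma expectedTabRisk_eq (h : IsRegressionFunction Q ηQ) (nQ nP kQ kP : ℕ) (τ : ℝ) :
    expectedTabRisk Q P ηQ nQ nP kQ kP τ = ∫ x, 2 * |ηQ x - 1 / 2| *
      (sampleLaw Q P nQ nP).real {D | tabKNN kQ kP τ D.1 D.2 x ≠ plugIn ηQ x} ∂(marginal Q) := by
  rw [expectedTabRisk]
  simp_rw [tabExcessRisk_eq h]
  rw [integral_integral_swap (integrable_tab_integrand h nQ nP kQ kP τ)]
  refine integral_congr_ae (ae_of_all _ fun x => ?_)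
  simp only
  rw [integral_const_mul]
  congr 1
  have hs : MeasurableSet {D : (Fin nQ → Obs d) × (Fin nP → Obs d) |
      tabKNN kQ kP τ D.1 D.2 x ≠ plugIn ηQ x} :=
    (measurableSet_eq_fun ((measurable_tabKNN kQ kP τ).comp measurable_prodMk_right)
      measurable_const).compl
  rw [← integral_indicator_one hs]
  refine integral_congr_ae (ae_of_all _ fun D => ?_)
  simp [indicator]

end Fubini

/-! ### Concentration of the nearest neighbour average. -/

section Concentration

open ProbabilityTheory unitInterval

/-- A labelled observation with regression function `η`, generated from a feature and an
independent uniform variable. -/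
noncomputable def attachLabel (η : E d → ℝ) (z : E d × I) : Obs d := (z.1, decide ((z.2 : ℝ) < η z.1))

lemma measurable_attachLabel {η : E d → ℝ} (hη : Measurable η) : Measurable (attachLabel η) := by
  refine measurable_fst.prodMk (measurable_to_bool ?_)
  have : MeasurableSet {z : E d × I | (z.2 : ℝ) < η z.1} :=
    measurableSet_lt (by fun_prop) (by fun_prop)
  simpa [preimage] using this

/-- Realises the label as `1{U < η(X)}` with `U` uniform and independent of `X`. Conditioning on the
features becomes freezing one factor of a product. The laws are compared on rectangles with label
`true`, then `false` by subtraction from the marginal. -/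
lemma measurePreserving_attachLabel {Q : Measure (Obs d)} [IsProbabilityMeasure Q] {η : E d → ℝ}
    (h : IsRegressionFunction Q η) :
    MeasurePreserving (attachLabel η) ((marginal Q).prod volume) Q := by
  have hm := measurable_attachLabel h.measurable
  refine ⟨hm, ?_⟩
  have htrue : ∀ B : Set (E d), MeasurableSet B →
      ((marginal Q).prod volume).map (attachLabel η) (B ×ˢ {true}) = Q (B ×ˢ {true}) := by
    intro B hB
    have hBm : MeasurableSet (B ×ˢ ({true} : Set Bool)) := hB.prod (measurableSet_singleton _)
    rw [Measure.map_apply hm hBm, Measure.prod_apply (hm hBm)]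
    have h1 : ∀ x, (volume : Measure I) (Prod.mk x ⁻¹' (attachLabel η ⁻¹' B ×ˢ {true})) =
        B.indicator (fun x => ENNReal.ofReal (η x)) x := by
      intro x
      by_cases hx : x ∈ B
      · have : Prod.mk x ⁻¹' (attachLabel η ⁻¹' B ×ˢ {true}) = Iio (⟨η x, h.mem_Icc x⟩ : I) := by
          ext u
          simp [attachLabel, hx, ← Subtype.coe_lt_coe]
        rw [this, unitInterval.volume_Iio, indicator_of_mem hx]
      · have : Prod.mk x ⁻¹' (attachLabel η ⁻¹' B ×ˢ {true}) = ∅ := by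
          ext u
          simp [attachLabel, hx]
        rw [this, measure_empty, indicator_of_notMem hx]
    simp_rw [h1]
    rw [lintegral_indicator hB, ← ofReal_integral_eq_lintegral_ofReal h.integrable.integrableOn
      (ae_of_all _ fun x => (h.mem_Icc x).1), h.setIntegral_eq B hB, ofReal_measureReal]
  have hmarg : ∀ B : Set (E d), MeasurableSet B →
      ((marginal Q).prod volume).map (attachLabel η) (Prod.fst ⁻¹' B) = Q (Prod.fst ⁻¹' B) := by
    intro B hB
    rw [Measure.map_apply hm (measurable_fst hB)]
    have : attachLabel η ⁻¹' (Prod.fst ⁻¹' B) = B ×ˢ (univ : Set I) := by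
      ext z; simp [attachLabel]
    rw [this, Measure.prod_prod, measure_univ, mul_one, marginal,
      Measure.map_apply measurable_fst hB]
  have : IsProbabilityMeasure (((marginal Q).prod (volume : Measure I)).map (attachLabel η)) :=
    Measure.isProbabilityMeasure_map hm.aemeasurable
  have hfalse : ∀ B : Set (E d), MeasurableSet B →
      ((marginal Q).prod volume).map (attachLabel η) (B ×ˢ {false}) = Q (B ×ˢ {false}) := by
    intro B hB
    have hBm : MeasurableSet (B ×ˢ ({true} : Set Bool)) := hB.prod (measurableSet_singleton _)
    have hs : B ×ˢ ({false} : Set Bool) = (Prod.fst ⁻¹' B) \ (B ×ˢ {true}) := by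
      ext ⟨x, y⟩
      rcases y <;> simp
    have hsub : B ×ˢ ({true} : Set Bool) ⊆ Prod.fst ⁻¹' B := fun z hz => hz.1
    rw [hs, measure_sdiff hsub hBm.nullMeasurableSet (measure_ne_top _ _),
      measure_sdiff hsub hBm.nullMeasurableSet (measure_ne_top _ _), htrue B hB, hmarg B hB]
  ext s hs
  have hsec : ∀ b : Bool, MeasurableSet ((fun x : E d => (x, b)) ⁻¹' s) := fun b =>
    measurable_prodMk_right hs
  have hsplit : s = ((fun x : E d => (x, true)) ⁻¹' s) ×ˢ {true} ∪
      ((fun x : E d => (x, false)) ⁻¹' s) ×ˢ {false} := by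
    ext ⟨x, y⟩
    rcases y <;> simp
  have hd : Disjoint (((fun x : E d => (x, true)) ⁻¹' s) ×ˢ ({true} : Set Bool))
      (((fun x : E d => (x, false)) ⁻¹' s) ×ˢ {false}) := by
    rw [Set.disjoint_left]
    rintro ⟨x, y⟩ h1 h2
    exact absurd (h1.2.symm.trans h2.2) (by simp)
  have hmf := (hsec false).prod (measurableSet_singleton false)
  rw [hsplit, measure_union hd hmf, measure_union hd hmf, htrue _ (hsec _), hfalse _ (hsec _)]

lemma measurePreserving_attachLabels {Q : Measure (Obs d)} [IsProbabilityMeasure Q] {η : E d → ℝ}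
    (h : IsRegressionFunction Q η) (n : ℕ) :
    MeasurePreserving (fun (z : (Fin n → E d) × (Fin n → I)) i => attachLabel η (z.1 i, z.2 i))
      ((Measure.pi fun _ => marginal Q).prod (Measure.pi fun _ => volume))
      (Measure.pi fun _ => Q) :=
  (measurePreserving_pi (fun _ : Fin n => (marginal Q).prod (volume : Measure I)) (fun _ => Q)
    fun _ => measurePreserving_attachLabel h).comp
      (measurePreserving_arrowProdEquivProdArrow (E d) I (Fin n) (fun _ => marginal Q)
        (fun _ => volume)).symm

/-- Hoeffding's inequality for the labels, conditionally on the features. -/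
lemma hoeffding_labels {n : ℕ} {p : Fin n → ℝ} (hp : ∀ i, p i ∈ Icc (0 : ℝ) 1) {a : ℝ}
    (ha : a = 1 ∨ a = -1) (s : Finset (Fin n)) {t : ℝ} (ht : 0 ≤ t) :
    (Measure.pi fun _ : Fin n => (volume : Measure I)).real
      {u | (s.card : ℝ) * t ≤ ∑ i ∈ s, a * (p i - labelValue (decide ((u i : ℝ) < p i)))} ≤
      Real.exp (-(2 * s.card * t ^ 2)) := by
  rcases s.eq_empty_or_nonempty with rfl | hne
  · simp
  have hlm : ∀ i, Measurable fun v : I => labelValue (decide ((v : ℝ) < p i)) := fun i =>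
    measurable_labelValue.comp (measurable_to_bool (by
      have : MeasurableSet {v : I | (v : ℝ) < p i} := measurableSet_lt (by fun_prop) (by fun_prop)
      simpa [preimage] using this))
  set f : Fin n → I → ℝ := fun i v => a * (p i - labelValue (decide ((v : ℝ) < p i))) with hf
  have hfm : ∀ i, Measurable (f i) := fun i => ((hlm i).const_sub _).const_mul _
  have hmean : ∀ i, ∫ v, f i v = 0 := by
    intro i
    have h1 : ∫ v : I, labelValue (decide ((v : ℝ) < p i)) = p i := by
      have h2 : (fun v : I => labelValue (decide ((v : ℝ) < p i))) =
          (Iio (⟨p i, hp i⟩ : I)).indicator 1 := by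
        ext v
        simp [labelValue, indicator, ← Subtype.coe_lt_coe]
      rw [h2, integral_indicator_one measurableSet_Iio, measureReal_def,
        unitInterval.volume_Iio, ENNReal.toReal_ofReal (hp i).1]
    have hint : Integrable (fun v : I => labelValue (decide ((v : ℝ) < p i))) :=
      Integrable.of_mem_Icc 0 1 (hlm i).aemeasurable (ae_of_all _ fun v => by
        unfold labelValue; split_ifs <;> simp)
    simp only [hf]
    rw [integral_const_mul, integral_sub (integrable_const _) hint, h1]
    simp
  have hind := iIndepFun_pi (μ := fun _ : Fin n => (volume : Measure I)) (X := f)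
    (fun i => (hfm i).aemeasurable)
  have hsub : ∀ i ∈ s, HasSubgaussianMGF (fun u : Fin n → I => f i (u i)) (1 / 4)
      (Measure.pi fun _ : Fin n => (volume : Measure I)) := by
    intro i _
    have hmeas : AEMeasurable (fun u : Fin n → I => f i (u i))
        (Measure.pi fun _ : Fin n => (volume : Measure I)) :=
      ((hfm i).comp (measurable_pi_apply i)).aemeasurable
    have h0 : ∫ u : Fin n → I, f i (u i) ∂(Measure.pi fun _ : Fin n => (volume : Measure I)) = 0 := by
      rw [integral_comp_eval (μ := fun _ : Fin n => (volume : Measure I))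
        (hfm i).aestronglyMeasurable, hmean]
    rcases ha with rfl | rfl
    -- The centred label ranges over an interval of length 1, so its variance proxy is `(1/2)^2 =
    -- 1/4`.
    · have := hasSubgaussianMGF_of_mem_Icc_of_integral_eq_zero (a := p i - 1) (b := p i) hmeas
        (ae_of_all _ fun u => by
          simp only [hf, labelValue]; split_ifs <;> simp) h0
      convert this using 1
      ext; simp; norm_num
    · have := hasSubgaussianMGF_of_mem_Icc_of_integral_eq_zero (a := - p i) (b := 1 - p i) hmeas
        (ae_of_all _ fun u => by
          simp only [hf, labelValue]; split_ifs <;> simp) h0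
      convert this using 1
      ext; simp; norm_num
  refine (HasSubgaussianMGF.measure_sum_ge_le_of_iIndepFun hind hsub
    (ε := s.card * t) (by positivity)).trans (le_of_eq ?_)
  congr 1
  have : (s.card : ℝ) ≠ 0 := by exact_mod_cast hne.card_pos.ne'
  simp
  field_simp
  ring

/-- If the value at position `i` exceeded `r`, all values at most `r` would sit at the `i` positions
before it, leaving fewer than `k` of them. -/
lemma dist_sort_le {n k : ℕ} {f : Fin n → ℝ} {r : ℝ}
    (h : k ≤ (Finset.univ.filter fun j => f j ≤ r).card) {i : Fin n} (hi : (i : ℕ) < k) :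
    f (Tuple.sort f i) ≤ r := by
  by_contra! hlt
  have hsub : (Finset.univ.filter fun j => f j ≤ r) ⊆
      (Finset.univ.filter fun j : Fin n => j < i).map (Tuple.sort f).toEmbedding := by
    intro j hj
    rw [Finset.mem_filter] at hj
    refine Finset.mem_map.2 ⟨(Tuple.sort f).symm j, ?_, by simp⟩
    rw [Finset.mem_filter]
    refine ⟨Finset.mem_univ _, ?_⟩
    by_contra! hle
    have := Tuple.monotone_sort f hle
    simp only [Function.comp_apply, Equiv.apply_symm_apply] at this
    linarith [hj.2]
  have h1 := Finset.card_le_card hsub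
  rw [Finset.card_map] at h1
  have h2 : (Finset.univ.filter fun j : Fin n => j < i).card = i := by
    rw [Finset.filter_gt_eq_Iio]
    simp
  omega

/-- Chernoff's bound for the lower tail of the number of sample points in a set. -/
lemma card_sample_lt {X : Type*} [MeasurableSpace X] (ν : Measure X) [IsProbabilityMeasure ν]
    {B : Set X} (hB : MeasurableSet B) [DecidablePred (· ∈ B)] {n k : ℕ} {M q : ℝ}
    (hq : q ≤ ν.real B) (hk : 2 * (M + 1) * k ≤ n * q) :
    (Measure.pi fun _ : Fin n => ν).real
      {x | (Finset.univ.filter fun i => x i ∈ B).card < k} ≤ Real.exp (-(M * k)) := by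
  -- The product of `g` over the sample is `exp(-count)`, to which Markov's inequality at level
  -- `exp(-k)` applies.
  set g : X → ℝ := fun y => if y ∈ B then Real.exp (-1) else 1 with hg
  have hgm : Measurable g := Measurable.ite hB measurable_const measurable_const
  have hprod : ∀ x : Fin n → X, ∏ i, g (x i) =
      Real.exp (-((Finset.univ.filter fun i => x i ∈ B).card : ℝ)) := by
    intro x
    simp only [hg]
    rw [Finset.prod_ite, Finset.prod_const, Finset.prod_const_one, mul_one, ← Real.exp_nat_mul]
    simp
  -- The integral is `1 - (1 - e⁻¹) ν(B) ≤ 1 - q/2`. Its `n`-th power is at most `exp(-(M+1)k)`, and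
  -- Markov's inequality costs a factor `exp k`.
  have hgI : ∫ y, g y ∂ν ≤ Real.exp (-(q / 2)) := by
    have h1 : g = fun y => 1 - B.indicator (fun _ => 1 - Real.exp (-1)) y := by
      ext y
      by_cases hy : y ∈ B <;> simp [hg, hy]
    rw [h1, integral_sub (integrable_const _) ((integrable_const _).indicator hB),
      integral_indicator hB, setIntegral_const]
    have h2 := Real.add_one_le_exp (-(q / 2))
    have h3 := Real.exp_neg_one_lt_half
    have h4 : (0 : ℝ) ≤ ν.real B := measureReal_nonneg
    simp only [integral_const, probReal_univ, smul_eq_mul, mul_one]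
    nlinarith
  have hg0 : ∀ y, 0 ≤ g y := fun y => by
    simp only [hg]; split_ifs <;> positivity
  have hgi : Integrable g ν := Integrable.of_mem_Icc 0 1 hgm.aemeasurable (ae_of_all _ fun y =>
    ⟨hg0 y, by simp only [hg]; split_ifs <;> simp⟩)
  have hint : Integrable (fun x : Fin n → X => ∏ i, g (x i)) (Measure.pi fun _ => ν) :=
    Integrable.fintype_prod (f := fun _ => g) (μ := fun _ => ν) fun _ => hgi
  have hmarkov := mul_meas_ge_le_integral_of_nonneg
    (ae_of_all (Measure.pi fun _ : Fin n => ν) fun x => Finset.prod_nonneg fun i _ => hg0 (x i))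
    hint (Real.exp (-(k : ℝ)))
  rw [integral_fintype_prod_eq_pow, Fintype.card_fin] at hmarkov
  have hle : (∫ y, g y ∂ν) ^ n ≤ Real.exp (-((M + 1) * k)) := by
    refine (pow_le_pow_left₀ (integral_nonneg hg0) hgI n).trans ?_
    rw [← Real.exp_nat_mul]
    exact Real.exp_le_exp.2 (by linarith)
  have hsub : (Measure.pi fun _ : Fin n => ν).real
      {x | (Finset.univ.filter fun i => x i ∈ B).card < k} ≤
      (Measure.pi fun _ : Fin n => ν).real {x | Real.exp (-(k : ℝ)) ≤ ∏ i, g (x i)} := by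
    refine measureReal_mono fun x hx => ?_
    rw [mem_ofPred_eq, hprod]
    have : ((Finset.univ.filter fun i => x i ∈ B).card : ℝ) < k := by exact_mod_cast hx
    exact Real.exp_le_exp.2 (by linarith)
  have hfin : Real.exp (-(k : ℝ)) * Real.exp (-(M * k)) = Real.exp (-((M + 1) * k)) := by
    rw [← Real.exp_add]; congr 1; ring
  have := Real.exp_pos (-(k : ℝ))
  rw [← hfin] at hle
  exact hsub.trans (le_of_mul_le_mul_left (hmarkov.trans hle) this)

/-- Tail bound for the nearest neighbour average when the (signed) regression function is at least
`m` on the part of the support in a ball of sufficient mass. -/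
theorem knnEstimate_tail {Q : Measure (Obs d)} [IsProbabilityMeasure Q] {η : E d → ℝ}
    (h : IsRegressionFunction Q η) {n k : ℕ} (hk0 : 0 < k) {M q r a m t : ℝ} {x : E d}
    (hq : q ≤ (marginal Q).real (Metric.closedBall x r)) (hk : 2 * (M + 1) * k ≤ n * q)
    (ha : a = 1 ∨ a = -1) (ht : 0 ≤ t)
    (hm : ∀ y ∈ Metric.closedBall x r, y ∈ (marginal Q).support → m ≤ a * η y) :
    (Measure.pi fun _ : Fin n => Q).real {D | a * knnEstimate D k x ≤ m - t} ≤
      Real.exp (-(2 * k * t ^ 2)) + Real.exp (-(M * k)) := by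
  classical
  set ν := Measure.pi fun _ : Fin n => marginal Q with hν
  set U := Measure.pi fun _ : Fin n => (volume : Measure I) with hU
  set B := {D : Fin n → Obs d | a * knnEstimate D k x ≤ m - t} with hB
  have hBm : MeasurableSet B :=
    measurableSet_le (((measurable_knnEstimate k).comp
      (measurable_id.prodMk measurable_const)).const_mul a) measurable_const
  set Φ := fun (z : (Fin n → E d) × (Fin n → I)) i => attachLabel η (z.1 i, z.2 i) with hΦ
  have hpres : MeasurePreserving Φ (ν.prod U) (Measure.pi fun _ => Q) :=
    measurePreserving_attachLabels h n
  set far : Set (Fin n → E d) :=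
    {X | (Finset.univ.filter fun i => X i ∈ Metric.closedBall x r).card < k} with hfar
  have hfarm : MeasurableSet far := by
    have h1 : Measurable fun X : Fin n → E d =>
        (Finset.univ.filter fun i => X i ∈ Metric.closedBall x r).card := by
      simp_rw [Finset.card_filter]
      refine Finset.measurable_sum _ fun i _ => Measurable.ite ?_ measurable_const measurable_const
      exact (measurable_pi_apply i) Metric.isClosed_closedBall.measurableSet
    exact measurableSet_lt h1 measurable_const
  have hsupp : ∀ᵐ X ∂ν, ∀ i, X i ∈ (marginal Q).support := by
    rw [ae_all_iff]
    intro i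
    exact (Measure.quasiMeasurePreserving_eval (fun _ : Fin n => marginal Q) i).ae
      Measure.support_mem_ae
  -- For fixed features the indices of the neighbours are fixed, so the section is a deviation event
  -- for independent labels. When fewer than `k` points are near, it is bounded by 1.
  have hsec : ∀ᵐ X ∂ν, U (Prod.mk X ⁻¹' (Φ ⁻¹' B)) ≤
      far.indicator (fun _ => 1) X + ENNReal.ofReal (Real.exp (-(2 * k * t ^ 2))) := by
    filter_upwards [hsupp] with X hX
    by_cases hXf : X ∈ far
    · rw [indicator_of_mem hXf]
      exact prob_le_one.trans le_self_add
    rw [indicator_of_notMem hXf, zero_add]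
    have hnear : k ≤ (Finset.univ.filter fun i => dist (X i) x ≤ r).card := by
      simpa [hfar] using hXf
    have hkn : k ≤ n := hnear.trans ((Finset.card_filter_le _ _).trans (by simp))
    set s : Finset (Fin n) := (Finset.univ.filter fun i : Fin n => (i : ℕ) < k).map
      (Tuple.sort fun j => dist (X j) x).toEmbedding with hs
    have hscard : s.card = k := by
      rw [hs, Finset.card_map, Fin.card_filter_val_lt]
      exact min_eq_right hkn
    have hho := hoeffding_labels (p := fun i => η (X i)) (fun i => h.mem_Icc _) ha s ht
    rw [hscard] at hho
    have hsub : Prod.mk X ⁻¹' (Φ ⁻¹' B) ⊆ {u | (k : ℝ) * t ≤ ∑ i ∈ s,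
        a * (η (X i) - labelValue (decide ((u i : ℝ) < η (X i))))} := by
      intro u hu
      have hu' : a * knnEstimate (Φ (X, u)) k x ≤ m - t := hu
      have hknn : knnEstimate (Φ (X, u)) k x =
          (k : ℝ)⁻¹ * ∑ i ∈ s, labelValue (decide ((u i : ℝ) < η (X i))) := by
        rw [hs, Finset.sum_map]
        -- Attaching labels leaves the features unchanged, so the sorting permutation does not
        -- depend on `u`.
        rfl
      rw [hknn] at hu'
      have hk' : (0 : ℝ) < k := by exact_mod_cast hk0
      have h1 : a * ∑ i ∈ s, labelValue (decide ((u i : ℝ) < η (X i))) ≤ k * (m - t) := by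
        have := mul_le_mul_of_nonneg_left hu' hk'.le
        calc _ = (k : ℝ) * (a * ((k : ℝ)⁻¹ *
              ∑ i ∈ s, labelValue (decide ((u i : ℝ) < η (X i))))) := by field_simp
          _ ≤ _ := this
      have h2 : (k : ℝ) * m ≤ ∑ i ∈ s, a * η (X i) := by
        rw [← hscard, ← nsmul_eq_mul]
        refine Finset.card_nsmul_le_sum _ _ _ fun i hi => hm _ ?_ (hX i)
        rw [hs, Finset.mem_map] at hi
        obtain ⟨j, hj, rfl⟩ := hi
        exact dist_sort_le hnear (Finset.mem_filter.1 hj).2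
      rw [mem_ofPred_eq]
      simp_rw [mul_sub]
      rw [Finset.sum_sub_distrib, ← Finset.mul_sum s (fun i => labelValue _)]
      linarith
    refine (measure_mono hsub).trans ?_
    rw [← ofReal_measureReal]
    exact ENNReal.ofReal_le_ofReal hho
  have hfarle : ν.real far ≤ Real.exp (-(M * k)) :=
    card_sample_lt (marginal Q) Metric.isClosed_closedBall.measurableSet hq hk
  have hmain : (Measure.pi fun _ : Fin n => Q) B ≤
      ENNReal.ofReal (Real.exp (-(2 * k * t ^ 2)) + Real.exp (-(M * k))) := by
    rw [← hpres.measure_preimage hBm.nullMeasurableSet, Measure.prod_apply (hpres.measurable hBm)]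
    refine (lintegral_mono_ae hsec).trans ?_
    rw [lintegral_add_right _ measurable_const, lintegral_indicator hfarm, lintegral_const,
      lintegral_const, Measure.restrict_apply_univ, one_mul, measure_univ, mul_one, add_comm,
      ENNReal.ofReal_add (Real.exp_pos _).le (Real.exp_pos _).le, ← ofReal_measureReal (s := far)]
    gcongr
  exact ENNReal.toReal_le_of_le_ofReal (by positivity) hmain

end Concentration

/-! ### Mass of small balls and the radius of the neighbourhood. -/

open Filter Topology

/-- Lower bound for the mass of small balls under the strong density condition. -/
lemma StrongDensity.le_measureReal_closedBall {ν : Measure (E d)} [IsProbabilityMeasure ν]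
    {μp μm cμ rμ : ℝ} (h : StrongDensity ν μp μm cμ rμ) (hμm : 0 ≤ μm) {x : E d}
    (hx : x ∈ ν.support) {r : ℝ} (hr : 0 < r) (hrμ : r < rμ) :
    μm * cμ * (volume : Measure (E d)).real (Metric.closedBall 0 1) * r ^ d ≤
      ν.real (Metric.closedBall x r) := by
  set S := ν.support
  have hS : MeasurableSet S := Measure.isClosed_support.measurableSet
  have hB : MeasurableSet (Metric.closedBall x r) := Metric.isClosed_closedBall.measurableSet
  have hvol : (volume : Measure (E d)).real (Metric.closedBall x r) =
      r ^ d * (volume : Measure (E d)).real (Metric.closedBall 0 1) := by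
    rw [Measure.addHaar_real_closedBall' _ _ hr.le, finrank_euclideanSpace_fin]
  have hvpos : 0 < (volume : Measure (E d)).real (Metric.closedBall x r) :=
    ENNReal.toReal_pos (Metric.measure_closedBall_pos _ _ hr).ne' measure_closedBall_lt_top.ne
  have h1 := (le_div_iff₀ hvpos).1 (h.regular x hx r hr hrμ)
  have h2 : ENNReal.ofReal μm * volume (Metric.closedBall x r ∩ S) ≤
      ν (Metric.closedBall x r ∩ S) := by
    conv_rhs => rw [← Measure.withDensity_rnDeriv_eq ν volume h.absolutelyContinuous,
      withDensity_apply _ (hB.inter hS)]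
    rw [← setLIntegral_const]
    refine lintegral_mono_ae ?_
    have := ae_restrict_of_ae_restrict_of_subset (inter_subset_right (s := Metric.closedBall x r))
      h.density
    filter_upwards [this] with y hy using hy.1
  have h3 : μm * (volume : Measure (E d)).real (Metric.closedBall x r ∩ S) ≤
      ν.real (Metric.closedBall x r ∩ S) := by
    have := ENNReal.toReal_mono (measure_ne_top ν _) h2
    rwa [ENNReal.toReal_mul, ENNReal.toReal_ofReal hμm] at this
  have h4 : ν.real (Metric.closedBall x r ∩ S) ≤ ν.real (Metric.closedBall x r) :=
    measureReal_mono inter_subset_left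
  rw [hvol] at h1
  nlinarith [mul_le_mul_of_nonneg_left h1 hμm]

lemma tendsto_natCast_rpow_atTop {e : ℝ} (he : 0 < e) :
    Tendsto (fun n : ℕ => (n : ℝ) ^ e) atTop atTop :=
  (tendsto_rpow_atTop he).comp tendsto_natCast_atTop_atTop

lemma tendsto_natCast_rpow_neg {e : ℝ} (he : 0 < e) :
    Tendsto (fun n : ℕ => (n : ℝ) ^ (-e)) atTop (𝓝 0) :=
  (tendsto_rpow_neg_atTop he).comp tendsto_natCast_atTop_atTop

lemma numNeighbors_le {c b : ℝ} (hc : 0 ≤ c) (n : ℕ) :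
    (numNeighbors d c b n : ℝ) ≤ c * (n : ℝ) ^ (2 * b / (2 * b + d)) :=
  Nat.floor_le (by positivity)

lemma eventually_le_numNeighbors {c b : ℝ} (hc : 0 < c) (hb : 0 < b) :
    ∀ᶠ n : ℕ in atTop, 0 < numNeighbors d c b n ∧
      c / 2 * (n : ℝ) ^ (2 * b / (2 * b + d)) ≤ numNeighbors d c b n := by
  have he : 0 < 2 * b / (2 * b + d) := by positivity
  filter_upwards [(tendsto_natCast_rpow_atTop he).eventually_ge_atTop (2 / c)] with n hn
  have h2 : 2 ≤ c * (n : ℝ) ^ (2 * b / (2 * b + d)) := by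
    rwa [div_le_iff₀' hc] at hn
  have hf := Nat.lt_floor_add_one (c * (n : ℝ) ^ (2 * b / (2 * b + d)))
  refine ⟨Nat.floor_pos.2 (by linarith), ?_⟩
  unfold numNeighbors
  linarith

/-- Tail bound for the nearest neighbour average with `⌊c n^{2b/(2b+d)}⌋` neighbours: all of them
lie within `A n^{-1/(2b+d)}` up to an exponentially small probability. -/
theorem exists_radius_knnEstimate_tail (hd : 0 < d) {c b M μm cμ rμ : ℝ} (hc : 0 < c) (hb : 0 < b)
    (hM : 0 ≤ M) (hμm : 0 < μm) (hcμ : 0 < cμ) (hrμ : 0 < rμ) :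
    ∃ A : ℝ, 0 < A ∧ ∀ᶠ n : ℕ in atTop, ∀ (Q : Measure (Obs d)) [IsProbabilityMeasure Q]
      (η : E d → ℝ) (μp : ℝ), IsRegressionFunction Q η → StrongDensity (marginal Q) μp μm cμ rμ →
      ∀ x ∈ featureSupport Q, ∀ a m t : ℝ, (a = 1 ∨ a = -1) → 0 ≤ t →
      (∀ y ∈ featureSupport Q, dist y x ≤ A * (n : ℝ) ^ (-(1 / (2 * b + d))) → m ≤ a * η y) →
      (Measure.pi fun _ : Fin n => Q).real {D | a * knnEstimate D (numNeighbors d c b n) x ≤ m - t} ≤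
        Real.exp (-(2 * numNeighbors d c b n * t ^ 2)) +
          Real.exp (-(M * numNeighbors d c b n)) := by
  set κ := μm * cμ * (volume : Measure (E d)).real (Metric.closedBall 0 1) with hκ
  have hv : 0 < (volume : Measure (E d)).real (Metric.closedBall 0 1) :=
    ENNReal.toReal_pos (Metric.measure_closedBall_pos _ _ one_pos).ne' measure_closedBall_lt_top.ne
  have hκpos : 0 < κ := by positivity
  -- The mean count in the ball is at least `κ A^d n^{2b/(2b+d)}`, which must exceed `2(M+1)k`.
  -- Taking `A ≥ 1` gives `A ≤ A^d`, so a linear lower bound on `A` is enough.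
  set A := max 1 (2 * (M + 1) * c / κ) with hA
  have hA1 : 1 ≤ A := le_max_left _ _
  have hApow : 2 * (M + 1) * c ≤ κ * A ^ d := by
    have h1 : A ≤ A ^ d := le_self_pow₀ hA1 hd.ne'
    have h2 : 2 * (M + 1) * c / κ ≤ A ^ d := (le_max_right _ _).trans h1
    rwa [div_le_iff₀' hκpos] at h2
  have he : 0 < 1 / (2 * b + d) := by positivity
  refine ⟨A, by positivity, ?_⟩
  have hsmall : ∀ᶠ n : ℕ in atTop, A * (n : ℝ) ^ (-(1 / (2 * b + d))) < rμ := by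
    have := (tendsto_natCast_rpow_neg he).const_mul A
    rw [mul_zero] at this
    exact this.eventually_lt_const hrμ
  filter_upwards [hsmall, eventually_gt_atTop 0, eventually_le_numNeighbors (d := d) hc hb]
    with n hn hn0 hk Q _ η μp hreg hsd x hx a m t ha ht hm
  have hn0' : (0 : ℝ) < n := by exact_mod_cast hn0
  have hmass := hsd.le_measureReal_closedBall hμm.le hx (by positivity) hn
  refine knnEstimate_tail hreg hk.1 hmass ?_ ha ht fun y hy hys => hm y hys hy
  have hpow : (n : ℝ) * ((n : ℝ) ^ (-(1 / (2 * b + d)))) ^ d =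
      (n : ℝ) ^ (2 * b / (2 * b + d)) := by
    rw [← Real.rpow_natCast, ← Real.rpow_mul hn0'.le]
    nth_rewrite 1 [← Real.rpow_one (n : ℝ)]
    rw [← Real.rpow_add hn0']
    congr 1
    field_simp
    ring
  calc 2 * (M + 1) * (numNeighbors d c b n : ℝ)
      ≤ 2 * (M + 1) * (c * (n : ℝ) ^ (2 * b / (2 * b + d))) := by
        gcongr
        exact numNeighbors_le hc.le n
    _ = 2 * (M + 1) * c * (n : ℝ) ^ (2 * b / (2 * b + d)) := by ring
    _ ≤ κ * A ^ d * (n : ℝ) ^ (2 * b / (2 * b + d)) := by gcongr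
    _ = n * (κ * (A * (n : ℝ) ^ (-(1 / (2 * b + d)))) ^ d) := by
        rw [← hpow, mul_pow]; ring

/-- For `u ≥ 1` a single term of the exponential series, of order `N ≥ m/s`, dominates `u ^ m`. The
base `1 + u` keeps the bound finite at `u = 0`. -/
lemma exists_exp_neg_rpow_le {c s : ℝ} (hc : 0 < c) (hs : 0 < s) {m : ℝ} (hm : 0 ≤ m) :
    ∃ C : ℝ, 0 < C ∧ ∀ u : ℝ, 0 ≤ u → Real.exp (-(c * u ^ s)) ≤ C * (1 + u) ^ (-m) := by
  obtain ⟨N, hN⟩ := exists_nat_ge (m / s)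
  have hNs : m ≤ s * N := by rwa [div_le_iff₀' hs] at hN
  refine ⟨2 ^ m * (1 + N.factorial / c ^ N), by positivity, fun u hu => ?_⟩
  rw [Real.exp_neg, Real.rpow_neg (by positivity), ← div_eq_mul_inv, inv_eq_one_div,
    div_le_div_iff₀ (Real.exp_pos _) (by positivity), one_mul]
  have hc0 : 0 ≤ c * u ^ s := by positivity
  have hexp : 1 ≤ Real.exp (c * u ^ s) := Real.one_le_exp hc0
  rcases le_total u 1 with h | h
  · have h1 : (1 + u) ^ m ≤ 2 ^ m := Real.rpow_le_rpow (by positivity) (by linarith) hm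
    have h2 : (0 : ℝ) ≤ 2 ^ m * (N.factorial / c ^ N) * Real.exp (c * u ^ s) := by positivity
    have h3 : (2 : ℝ) ^ m * 1 ≤ 2 ^ m * Real.exp (c * u ^ s) := by gcongr
    linarith
  · have h1 : (1 + u) ^ m ≤ 2 ^ m * u ^ m := by
      rw [← Real.mul_rpow (by norm_num) hu]
      exact Real.rpow_le_rpow (by positivity) (by linarith) hm
    have h2 : u ^ m ≤ (u ^ s) ^ N := by
      rw [← Real.rpow_natCast, ← Real.rpow_mul hu]
      exact Real.rpow_le_rpow_of_exponent_le h hNs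
    have h3 : (u ^ s) ^ N ≤ N.factorial / c ^ N * Real.exp (c * u ^ s) := by
      have h4 := Real.pow_div_factorial_le_exp (c * u ^ s) hc0 N
      rw [mul_pow] at h4
      rw [div_le_iff₀ (by positivity)] at h4
      rw [div_mul_eq_mul_div, le_div_iff₀ (by positivity)]
      linarith
    have h5 : (2 : ℝ) ^ m * u ^ m ≤ 2 ^ m * (N.factorial / c ^ N * Real.exp (c * u ^ s)) := by
      gcongr
      exact h2.trans h3
    have h6 : 0 ≤ (2 : ℝ) ^ m * Real.exp (c * u ^ s) := by positivity
    linarith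

/-! ### Consequences of the margin condition. -/

section

variable {ν : Measure (E d)} [IsProbabilityMeasure ν] {η : E d → ℝ} {α Cα : ℝ}

lemma measurableSet_margin (hη : Measurable η) (z : ℝ) :
    MeasurableSet {x | 0 < |η x - 1 / 2| ∧ |η x - 1 / 2| ≤ z} := by
  have hζ : Measurable fun x => |η x - 1 / 2| := by fun_prop
  exact (measurableSet_lt measurable_const hζ).inter (measurableSet_le hζ measurable_const)

lemma integrable_abs_sub_half (hη : Measurable η) (hη1 : ∀ x, η x ∈ Icc (0 : ℝ) 1) :
    Integrable (fun x => |η x - 1 / 2|) ν :=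
  Integrable.of_mem_Icc 0 (1 / 2) (by fun_prop) (ae_of_all _ fun x =>
    ⟨abs_nonneg _, abs_sub_half_le (hη1 x)⟩)

/-- The margin condition says nothing about `{η = 1/2}`, but the integrand vanishes there. Elsewhere
the integrand is at most `z` on a set of mass at most `Cα z^α`. -/
lemma Margin.setIntegral_le (h : Margin ν η α Cα) (hη : Measurable η)
    (hη1 : ∀ x, η x ∈ Icc (0 : ℝ) 1) {z : ℝ} (hz : 0 < z) :
    ∫ x in {x | |η x - 1 / 2| ≤ z}, |η x - 1 / 2| ∂ν ≤ Cα * z ^ (1 + α) := by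
  have hm : MeasurableSet {x | |η x - 1 / 2| ≤ z} :=
    measurableSet_le (by fun_prop) measurable_const
  rw [← integral_indicator hm]
  have hle : ∀ x, {x | |η x - 1 / 2| ≤ z}.indicator (fun x => |η x - 1 / 2|) x ≤
      {x | 0 < |η x - 1 / 2| ∧ |η x - 1 / 2| ≤ z}.indicator (fun _ => z) x := by
    intro x
    have h0 := abs_nonneg (η x - 1 / 2)
    by_cases h1 : |η x - 1 / 2| ≤ z
    · rcases h0.eq_or_lt with h2 | h2
      · rw [indicator_of_mem (show x ∈ {x | |η x - 1 / 2| ≤ z} from h1), ← h2]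
        exact indicator_nonneg (fun _ _ => hz.le) _
      · rw [indicator_of_mem (show x ∈ {x | |η x - 1 / 2| ≤ z} from h1), indicator_of_mem
          (show x ∈ {x | 0 < |η x - 1 / 2| ∧ |η x - 1 / 2| ≤ z} from ⟨h2, h1⟩)]
        exact h1
    · rw [indicator_of_notMem (show x ∉ {x | |η x - 1 / 2| ≤ z} from h1)]
      exact indicator_nonneg (fun _ _ => hz.le) _
  refine (integral_mono ((integrable_abs_sub_half hη hη1).indicator hm)
    ((integrable_const z).indicator (measurableSet_margin hη z)) hle).trans ?_
  rw [integral_indicator (measurableSet_margin hη z), setIntegral_const, smul_eq_mul,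
    Real.rpow_add hz, Real.rpow_one]
  nlinarith [h z hz]

end

/-- The contribution of an exponentially small error probability, by peeling. -/
lemma exists_integral_mul_exp_le {c γ α Cα : ℝ} (hc : 0 < c) (hγ : 0 < γ) (hα : 0 ≤ α)
    (hCα : 0 < Cα) :
    ∃ C : ℝ, 0 < C ∧ ∀ (ν : Measure (E d)) [IsProbabilityMeasure ν] (η : E d → ℝ),
      Margin ν η α Cα → Measurable η → ∀ h : ℝ, 0 < h →
      ∫ x, |η x - 1 / 2| * Real.exp (-(c * (|η x - 1 / 2| / h) ^ (2 * γ))) ∂ν ≤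
        C * h ^ (1 + α) := by
  -- Decay of order `2 + α` pays one power of `2^j` for the size of the integrand and `α` powers for
  -- the mass of `S j`, leaving the summable factor `2^{-j}`.
  obtain ⟨C₀, hC₀, hexp⟩ := exists_exp_neg_rpow_le hc (show 0 < 2 * γ by positivity)
    (show 0 ≤ 2 + α by positivity)
  set C₁ := C₀ * 2 ^ (2 + α) with hC₁
  refine ⟨2 * (C₁ * Cα), by positivity, fun ν _ η hmar hη h hh => ?_⟩
  set S : ℕ → Set (E d) := fun j => {x | 0 < |η x - 1 / 2| ∧ |η x - 1 / 2| ≤ 2 ^ j * h} with hS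
  have hSm : ∀ j, MeasurableSet (S j) := fun j => measurableSet_margin hη _
  set w : ℕ → ℝ := fun j => C₁ * h * ((2 : ℝ) ^ j * ((2 : ℝ) ^ j) ^ (-(2 + α))) with hw
  have hpt : ∀ x, ENNReal.ofReal (|η x - 1 / 2| *
      Real.exp (-(c * (|η x - 1 / 2| / h) ^ (2 * γ)))) ≤
      ∑' j, (S j).indicator (fun _ => ENNReal.ofReal (w j)) x := by
    intro x
    set ζ := |η x - 1 / 2| with hζ
    rcases (abs_nonneg (η x - 1 / 2)).eq_or_lt with h0 | h0
    · rw [hζ, ← h0]; simp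
    have hex : ∃ j : ℕ, ζ ≤ 2 ^ j * h := by
      obtain ⟨j, hj⟩ := pow_unbounded_of_one_lt (ζ / h) (one_lt_two : (1 : ℝ) < 2)
      exact ⟨j, by rw [div_lt_iff₀ hh] at hj; exact hj.le⟩
    classical
    -- Minimality of `j` gives `2^j ≤ 2(1 + ζ/h)`, which turns decay in `ζ/h` into decay in `2^j`;
    -- the case `j = 0` is trivial.
    set j := Nat.find hex
    have hj : ζ ≤ 2 ^ j * h := Nat.find_spec hex
    have hu : 0 ≤ ζ / h := by positivity
    have hju : (2 : ℝ) ^ j ≤ 2 * (1 + ζ / h) := by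
      rcases Nat.eq_zero_or_pos j with h1 | h1
      · rw [h1, pow_zero]; linarith
      · have h2 : ¬ ζ ≤ 2 ^ (j - 1) * h := Nat.find_min hex (by omega)
        have h3 : (2 : ℝ) ^ (j - 1) < ζ / h := by
          rw [lt_div_iff₀ hh]; exact not_le.1 h2
        have h4 : (2 : ℝ) ^ j = 2 * 2 ^ (j - 1) := by
          rw [← pow_succ']; congr 1; omega
        linarith
    refine le_trans ?_ (ENNReal.le_tsum j)
    rw [indicator_of_mem (show x ∈ S j from ⟨h0, hj⟩)]
    refine ENNReal.ofReal_le_ofReal ?_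
    have h5 : Real.exp (-(c * (ζ / h) ^ (2 * γ))) ≤ C₁ * ((2 : ℝ) ^ j) ^ (-(2 + α)) := by
      refine (hexp _ hu).trans ?_
      rw [hC₁, mul_assoc]
      gcongr
      have h6 : (2 : ℝ) ^ j / 2 ≤ 1 + ζ / h := by linarith
      refine (Real.rpow_le_rpow_of_nonpos (by positivity) h6 (by linarith)).trans (le_of_eq ?_)
      rw [Real.div_rpow (by positivity) (by norm_num), Real.rpow_neg (by norm_num : (0:ℝ) ≤ 2)]
      field_simp
    calc ζ * Real.exp (-(c * (ζ / h) ^ (2 * γ)))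
        ≤ (2 ^ j * h) * (C₁ * ((2 : ℝ) ^ j) ^ (-(2 + α))) := by gcongr
      _ = w j := by simp only [hw]; ring
  have hterm : ∀ j, ∫⁻ x, (S j).indicator (fun _ => ENNReal.ofReal (w j)) x ∂ν ≤
      ENNReal.ofReal (C₁ * Cα * h ^ (1 + α) * (1 / 2) ^ j) := by
    intro j
    have h2j : (0 : ℝ) < 2 ^ j := by positivity
    rw [lintegral_indicator (hSm j), lintegral_const, Measure.restrict_apply_univ,
      ← ofReal_measureReal, ← ENNReal.ofReal_mul (by positivity)]
    refine ENNReal.ofReal_le_ofReal ?_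
    calc w j * ν.real (S j) ≤ w j * (Cα * (2 ^ j * h) ^ α) := by
          gcongr
          exact hmar _ (by positivity)
      _ = C₁ * Cα * h ^ (1 + α) * (1 / 2) ^ j := by
          simp only [hw]
          rw [Real.mul_rpow h2j.le hh.le, Real.rpow_add hh, Real.rpow_one, Real.rpow_neg h2j.le,
            Real.rpow_add h2j, Real.rpow_two, one_div, inv_pow]
          have := (Real.rpow_pos_of_pos h2j α).ne'
          field_simp
  have hint0 : ∀ x, 0 ≤ |η x - 1 / 2| * Real.exp (-(c * (|η x - 1 / 2| / h) ^ (2 * γ))) :=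
    fun x => by positivity
  rw [integral_eq_lintegral_of_nonneg_ae (ae_of_all _ hint0) (by
    refine Measurable.aestronglyMeasurable ?_
    fun_prop)]
  refine ENNReal.toReal_le_of_le_ofReal (by positivity) ?_
  calc ∫⁻ x, ENNReal.ofReal (|η x - 1 / 2| *
        Real.exp (-(c * (|η x - 1 / 2| / h) ^ (2 * γ)))) ∂ν
      ≤ ∫⁻ x, ∑' j, (S j).indicator (fun _ => ENNReal.ofReal (w j)) x ∂ν := lintegral_mono hpt
    _ = ∑' j, ∫⁻ x, (S j).indicator (fun _ => ENNReal.ofReal (w j)) x ∂ν :=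
        lintegral_tsum fun j => (measurable_const.indicator (hSm j)).aemeasurable
    _ ≤ ∑' j, ENNReal.ofReal (C₁ * Cα * h ^ (1 + α) * (1 / 2) ^ j) := ENNReal.tsum_le_tsum hterm
    _ = ENNReal.ofReal (2 * (C₁ * Cα) * h ^ (1 + α)) := by
        rw [← ENNReal.ofReal_tsum_of_nonneg (fun j => by positivity)
          (summable_geometric_two.mul_left _), tsum_mul_left, tsum_geometric_two]
        congr 1; ring

/-! ### Pointwise error of the two-stage rule. -/

/-- Probability that the target estimate at `x` is off by at least `τ`. -/
noncomputable def deviationProb (Q : Measure (Obs d)) (ηQ : E d → ℝ) (n k : ℕ) (τ : ℝ) (x : E d) :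
    ℝ :=
  (Measure.pi fun _ : Fin n => Q).real {D | τ ≤ |knnEstimate D k x - ηQ x|}

/-- Probability that the plug-in rule of the source estimate disagrees with the Bayes rule
at `x`. -/
noncomputable def disagreeProb (P : Measure (Obs d)) (ηQ : E d → ℝ) (n k : ℕ) (x : E d) : ℝ :=
  (Measure.pi fun _ : Fin n => P).real {D | plugIn (knnEstimate D k) x ≠ plugIn ηQ x}

/-- An estimate at distance at least `τ` from 1/2 and less than `τ` from `ηQ x` lies on the same
side of 1/2 as `ηQ x`. If instead it is within `τ` of 1/2, the triangle inequality gives `2τ`. -/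
lemma tabKNN_ne_imp {nQ nP kQ kP : ℕ} {τ : ℝ} {DQ : Fin nQ → Obs d} {DP : Fin nP → Obs d}
    {ηQ : E d → ℝ} {x : E d} (h : tabKNN kQ kP τ DQ DP x ≠ plugIn ηQ x)
    (hd : |knnEstimate DQ kQ x - ηQ x| < τ) :
    |ηQ x - 1 / 2| < 2 * τ ∧ plugIn (knnEstimate DP kP) x ≠ plugIn ηQ x := by
  unfold tabKNN at h
  have hd' := abs_lt.1 hd
  split_ifs at h with hτ
  · exfalso
    apply h
    unfold plugIn
    rw [decide_eq_decide]
    rcases le_abs.1 hτ with h1 | h1 <;> constructor <;> intro h2 <;> linarith [hd'.1, hd'.2]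
  · refine ⟨?_, h⟩
    have h1 := abs_lt.1 (not_le.1 hτ)
    exact abs_lt.2 ⟨by linarith [hd'.1, hd'.2], by linarith [hd'.1, hd'.2]⟩

lemma measureReal_tabKNN_ne_le {Q P : Measure (Obs d)} [IsProbabilityMeasure Q]
    [IsProbabilityMeasure P] (ηQ : E d → ℝ) (nQ nP kQ kP : ℕ) (τ : ℝ) (x : E d) :
    (sampleLaw Q P nQ nP).real {D | tabKNN kQ kP τ D.1 D.2 x ≠ plugIn ηQ x} ≤
      deviationProb Q ηQ nQ kQ τ x +
        (if |ηQ x - 1 / 2| < 2 * τ then disagreeProb P ηQ nP kP x else 0) := by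
  set S := {D : Fin nQ → Obs d | τ ≤ |knnEstimate D kQ x - ηQ x|}
  set T := {D : Fin nP → Obs d | plugIn (knnEstimate D kP) x ≠ plugIn ηQ x}
  have hS : (sampleLaw Q P nQ nP).real (S ×ˢ univ) = deviationProb Q ηQ nQ kQ τ x := by
    rw [sampleLaw, measureReal_prod_prod, probReal_univ, mul_one]; rfl
  have hT : (sampleLaw Q P nQ nP).real (univ ×ˢ T) = disagreeProb P ηQ nP kP x := by
    rw [sampleLaw, measureReal_prod_prod, probReal_univ, one_mul]; rfl
  split_ifs with hζ
  · rw [← hS, ← hT]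
    refine (measureReal_mono fun D hD => ?_).trans (measureReal_union_le _ _)
    by_cases h : τ ≤ |knnEstimate D.1 kQ x - ηQ x|
    · exact Or.inl ⟨h, trivial⟩
    · exact Or.inr ⟨trivial, (tabKNN_ne_imp hD (not_le.1 h)).2⟩
  · rw [← hS, add_zero]
    refine measureReal_mono fun D hD => ⟨?_, trivial⟩
    by_contra h
    exact hζ (tabKNN_ne_imp hD (not_le.1 h)).1

lemma deviationProb_nonneg (Q : Measure (Obs d)) (ηQ : E d → ℝ) (n k : ℕ) (τ : ℝ) (x : E d) :
    0 ≤ deviationProb Q ηQ n k τ x := measureReal_nonneg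

lemma disagreeProb_nonneg (P : Measure (Obs d)) (ηQ : E d → ℝ) (n k : ℕ) (x : E d) :
    0 ≤ disagreeProb P ηQ n k x := measureReal_nonneg

lemma disagreeProb_le_one (P : Measure (Obs d)) [IsProbabilityMeasure P] (ηQ : E d → ℝ)
    (n k : ℕ) (x : E d) : disagreeProb P ηQ n k x ≤ 1 := measureReal_le_one

lemma deviationProb_le {Q : Measure (Obs d)} [IsProbabilityMeasure Q] {ηQ : E d → ℝ} {n k : ℕ}
    {τ r : ℝ} {x : E d}
    (h : ∀ a : ℝ, a = 1 ∨ a = -1 →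
      (Measure.pi fun _ : Fin n => Q).real {D | a * knnEstimate D k x ≤ a * ηQ x - τ} ≤ r) :
    deviationProb Q ηQ n k τ x ≤ 2 * r := by
  have h1 := h 1 (Or.inl rfl)
  have h2 := h (-1) (Or.inr rfl)
  refine (measureReal_mono (s₂ := {D : Fin n → Obs d | 1 * knnEstimate D k x ≤ 1 * ηQ x - τ} ∪
    {D | -1 * knnEstimate D k x ≤ -1 * ηQ x - τ}) fun D hD => ?_).trans
    ((measureReal_union_le _ _).trans (by linarith))
  rcases le_abs.1 (show τ ≤ |knnEstimate D k x - ηQ x| from hD) with h3 | h3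
  · refine Or.inr ?_
    rw [mem_ofPred_eq]
    linarith
  · refine Or.inl ?_
    rw [mem_ofPred_eq]
    linarith

/-- The inequality in the event is not strict, because the plug-in rule answers `true` at a tie,
which is an error when `ηQ x < 1/2`. -/
lemma disagreeProb_le {P : Measure (Obs d)} [IsProbabilityMeasure P] {ηQ : E d → ℝ} {n k : ℕ}
    {r : ℝ} {x : E d} (hx : 0 < |ηQ x - 1 / 2|)
    (h : (Measure.pi fun _ : Fin n => P).real {D | Real.sign (ηQ x - 1 / 2) * knnEstimate D k x ≤
      Real.sign (ηQ x - 1 / 2) * (1 / 2)} ≤ r) :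
    disagreeProb P ηQ n k x ≤ r := by
  refine (measureReal_mono fun D hD => ?_).trans h
  have hD' : ¬ (1 / 2 ≤ knnEstimate D k x ↔ 1 / 2 ≤ ηQ x) := by
    intro h'
    exact hD (decide_eq_decide.2 h')
  rw [mem_ofPred_eq]
  rcases lt_or_gt_of_ne (abs_pos.1 hx) with h1 | h1
  · rw [Real.sign_of_neg h1]
    by_contra h2
    exact hD' ⟨fun _ => by linarith, fun _ => by linarith⟩
  · rw [Real.sign_of_pos h1]
    by_contra h2
    exact hD' ⟨fun _ => by linarith, fun _ => by linarith⟩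

lemma sign_eq_one_or {y : ℝ} (hy : 0 < |y|) : Real.sign y = 1 ∨ Real.sign y = -1 := by
  rcases lt_or_gt_of_ne (abs_pos.1 hy) with h1 | h1
  · exact Or.inr (Real.sign_of_neg h1)
  · exact Or.inl (Real.sign_of_pos h1)

/-- A signal above a nonnegative level excludes both sources of the value 0: a point outside `ΩP`,
and truncation of the positive part. -/
lemma signalStrength_pos_imp {ΩP : Set (E d)} {ηQ ηP : E d → ℝ} {x : E d} {v : ℝ} (hv : 0 ≤ v)
    (h : v < signalStrength ΩP ηQ ηP x) :
    x ∈ ΩP ∧ v < Real.sign (ηQ x - 1 / 2) * (ηP x - 1 / 2) := by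
  unfold signalStrength at h
  by_cases hx : x ∈ ΩP
  · rw [indicator_of_mem hx] at h
    rcases lt_max_iff.1 h with h1 | h1
    · exact ⟨hx, h1⟩
    · linarith
  · rw [indicator_of_notMem hx] at h
    linarith

/-- Lets sets whose measurability is not established, such as the boundary set, be replaced by
measurable hulls at no cost. -/
lemma setIntegral_toMeasurable {X : Type*} [MeasurableSpace X] (ν : Measure X) [IsFiniteMeasure ν]
    (s : Set X) (f : X → ℝ) :
    ∫ x, (toMeasurable ν s).indicator f x ∂ν = ∫ x in s, f x ∂ν := by
  rw [integral_indicator (measurableSet_toMeasurable _ _),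
    Measure.restrict_toMeasurable (measure_ne_top _ _)]

/-! ### Integrated risk bounds. -/

section Risk

variable {p : Params} {ε : ℝ → ℝ} {Q P : Measure (Obs d)} {ηQ ηP : E d → ℝ}

/-- Bound for the expected risk by the target sample alone. -/
lemma NPClass.expectedTabRisk_le_target (h : NPClass p ε Q P ηQ ηP) {nQ nP kQ kP : ℕ} {τ R : ℝ}
    (hτ : 0 < τ) (hQ : ∀ x ∈ featureSupport Q, deviationProb Q ηQ nQ kQ τ x ≤ R) :
    expectedTabRisk Q P ηQ nQ nP kQ kP τ ≤ 2 * (R + p.Cα * (2 * τ) ^ (1 + p.α)) := by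
  have := h.probQ
  have := h.probP
  have hηm := h.regQ.measurable
  have hint := integrable_abs_sub_half (ν := marginal Q) hηm h.regQ.mem_Icc
  have hms : MeasurableSet {x | |ηQ x - 1 / 2| ≤ 2 * τ} :=
    measurableSet_le (by fun_prop) measurable_const
  have hmar := h.margin.setIntegral_le hηm h.regQ.mem_Icc (show 0 < 2 * τ by linarith)
  rw [expectedTabRisk_eq h.regQ]
  have hle : ∫ x, 2 * |ηQ x - 1 / 2| *
      (sampleLaw Q P nQ nP).real {D | tabKNN kQ kP τ D.1 D.2 x ≠ plugIn ηQ x} ∂(marginal Q) ≤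
      ∫ x, 2 * (R + {x | |ηQ x - 1 / 2| ≤ 2 * τ}.indicator (fun x => |ηQ x - 1 / 2|) x)
        ∂(marginal Q) := by
    refine integral_mono_of_nonneg (ae_of_all _ fun x => by positivity)
      (((integrable_const _).add (hint.indicator hms)).const_mul 2) ?_
    filter_upwards [Measure.support_mem_ae (μ := marginal Q)] with x hx
    have h1 := measureReal_tabKNN_ne_le (Q := Q) (P := P) ηQ nQ nP kQ kP τ x
    have h2 := hQ x hx
    have h3 := abs_sub_half_le (h.regQ.mem_Icc x)
    have h4 := abs_nonneg (ηQ x - 1 / 2)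
    have h5 := deviationProb_nonneg Q ηQ nQ kQ τ x
    rw [mul_assoc]
    refine mul_le_mul_of_nonneg_left ?_ zero_le_two
    by_cases hζ : |ηQ x - 1 / 2| < 2 * τ
    · rw [if_pos hζ] at h1
      rw [indicator_of_mem (show x ∈ {x | |ηQ x - 1 / 2| ≤ 2 * τ} from hζ.le)]
      nlinarith [disagreeProb_le_one P ηQ nP kP x]
    · rw [if_neg hζ] at h1
      have h6 : 0 ≤ {x | |ηQ x - 1 / 2| ≤ 2 * τ}.indicator (fun x => |ηQ x - 1 / 2|) x :=
        indicator_nonneg (fun _ _ => abs_nonneg _) _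
      nlinarith
  refine hle.trans ?_
  rw [integral_const_mul, integral_add (integrable_const _) (hint.indicator hms),
    integral_indicator hms]
  simp only [integral_const, probReal_univ, one_smul]
  linarith

/-- Bound for the expected risk in terms of the source: outside the ambiguous region, the
exceptional region `G` and the region `|η - 1/2| ≤ z`, the source estimate errs with small
probability. -/
lemma NPClass.expectedTabRisk_le_source (h : NPClass p ε Q P ηQ ηP) {nQ nP kQ kP : ℕ}
    {τ R R' c b z C : ℝ} (hτ : 0 ≤ τ) (hz : 0 < z) (hc : 0 ≤ c) (hb : 0 < b) (G : Set (E d))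
    (hQ : ∀ x ∈ featureSupport Q, deviationProb Q ηQ nQ kQ τ x ≤ R) (hR' : 0 ≤ R')
    (hC : ∫ x, |ηQ x - 1 / 2| * Real.exp (-(c * (|ηQ x - 1 / 2| / b) ^ (2 * p.γ))) ∂(marginal Q) ≤
        C * b ^ (1 + p.α))
    (hP : ∀ x ∈ featureSupport Q, x ∉ G → x ∈ featureSupport P → z < |ηQ x - 1 / 2| →
      p.Cγ * |ηQ x - 1 / 2| ^ p.γ < Real.sign (ηQ x - 1 / 2) * (ηP x - 1 / 2) →
      disagreeProb P ηQ nP kP x ≤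
        Real.exp (-(c * (|ηQ x - 1 / 2| / b) ^ (2 * p.γ))) + R') :
    expectedTabRisk Q P ηQ nQ nP kQ kP τ ≤ 2 * (R + R' + p.Cα * z ^ (1 + p.α) +
      C * b ^ (1 + p.α) + (∫ x in G, |ηQ x - 1 / 2| ∂(marginal Q)) + ambiguityAt ε τ) := by
  have := h.probQ
  have := h.probP
  have hηm := h.regQ.measurable
  set ν := marginal Q with hν
  set ζ : E d → ℝ := fun x => |ηQ x - 1 / 2| with hζ
  have hζ0 : ∀ x, 0 ≤ ζ x := fun x => abs_nonneg _
  have hζm : Measurable ζ := by fun_prop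
  have hint : Integrable ζ ν := integrable_abs_sub_half hηm h.regQ.mem_Icc
  have hms : MeasurableSet {x | ζ x ≤ z} := measurableSet_le hζm measurable_const
  have hmar : ∫ x in {x | ζ x ≤ z}, ζ x ∂ν ≤ p.Cα * z ^ (1 + p.α) :=
    h.margin.setIntegral_le hηm h.regQ.mem_Icc hz
  set A : Set (E d) := {x | signalStrength (featureSupport P) ηQ ηP x ≤ p.Cγ * ζ x ^ p.γ ∧
    ζ x ≤ min (2 * τ) (1 / 2)} with hA
  have hamb : ∫ x in A, ζ x ∂ν ≤ ambiguityAt ε τ :=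
    h.ambiguity.bound _ ⟨le_min (by linarith) (by norm_num), min_le_right _ _⟩
  set e : E d → ℝ := fun x => ζ x * Real.exp (-(c * (ζ x / b) ^ (2 * p.γ))) with he
  have he0 : ∀ x, 0 ≤ e x := fun x => mul_nonneg (hζ0 x) (Real.exp_pos _).le
  have hei : Integrable e ν := by
    refine hint.mono' (by fun_prop) (ae_of_all _ fun x => ?_)
    rw [Real.norm_of_nonneg (he0 x)]
    refine mul_le_of_le_one_right (hζ0 x) (Real.exp_le_one_iff.2 ?_)
    have := Real.rpow_nonneg (div_nonneg (hζ0 x) hb.le) (2 * p.γ)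
    nlinarith
  set iA := (toMeasurable ν A).indicator ζ with hiA
  set iG := (toMeasurable ν G).indicator ζ with hiG
  set iz := {x | ζ x ≤ z}.indicator ζ with hiz
  have hnn : ∀ s : Set (E d), ∀ x, 0 ≤ s.indicator ζ x := fun s x =>
    indicator_nonneg (fun y _ => hζ0 y) x
  have hiAi : Integrable iA ν := hint.indicator (measurableSet_toMeasurable _ _)
  have hiGi : Integrable iG ν := hint.indicator (measurableSet_toMeasurable _ _)
  have hizi : Integrable iz ν := hint.indicator hms
  have hI1 : Integrable (fun x => R + R' + iz x) ν := (integrable_const _).add hizi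
  have hI2 : Integrable (fun x => R + R' + iz x + e x) ν := hI1.add hei
  have hI3 : Integrable (fun x => R + R' + iz x + e x + iG x) ν := hI2.add hiGi
  have hI4 : Integrable (fun x => R + R' + iz x + e x + iG x + iA x) ν := hI3.add hiAi
  rw [expectedTabRisk_eq h.regQ]
  have hle : ∫ x, 2 * |ηQ x - 1 / 2| *
      (sampleLaw Q P nQ nP).real {D | tabKNN kQ kP τ D.1 D.2 x ≠ plugIn ηQ x} ∂ν ≤
      ∫ x, 2 * (R + R' + iz x + e x + iG x + iA x) ∂ν := by
    refine integral_mono_of_nonneg (ae_of_all _ fun x => by positivity) (hI4.const_mul 2) ?_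
    filter_upwards [Measure.support_mem_ae (μ := ν)] with x hx
    have h1 := measureReal_tabKNN_ne_le (Q := Q) (P := P) ηQ nQ nP kQ kP τ x
    have h2 := hQ x hx
    have h3 : ζ x ≤ 1 / 2 := abs_sub_half_le (h.regQ.mem_Icc x)
    have h5 := deviationProb_nonneg Q ηQ nQ kQ τ x
    have h6 := disagreeProb_le_one P ηQ nP kP x
    have h7 := disagreeProb_nonneg P ηQ nP kP x
    rw [mul_assoc]
    refine mul_le_mul_of_nonneg_left ?_ zero_le_two
    change ζ x * _ ≤ _
    -- In the ambiguous, exceptional and small-margin regions the matching indicator already pays `ζ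
    -- x`; only in what remains must the source vote be reliable.
    have hdis : ζ x * (if ζ x < 2 * τ then disagreeProb P ηQ nP kP x else 0) ≤
        R' + iz x + e x + iG x + iA x := by
      have hA0 : 0 ≤ iA x := hnn _ x
      have hG0 : 0 ≤ iG x := hnn _ x
      have hz0 : 0 ≤ iz x := hnn _ x
      have := he0 x
      split_ifs with hζτ
      swap
      · rw [mul_zero]; positivity
      have hone : ζ x * disagreeProb P ηQ nP kP x ≤ ζ x := mul_le_of_le_one_right (hζ0 x) h6
      by_cases hxA : x ∈ toMeasurable ν A
      · have : iA x = ζ x := indicator_of_mem hxA _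
        linarith
      by_cases hxG : x ∈ toMeasurable ν G
      · have : iG x = ζ x := indicator_of_mem hxG _
        linarith
      by_cases hxz : ζ x ≤ z
      · have : iz x = ζ x := indicator_of_mem (show x ∈ {x | ζ x ≤ z} from hxz) _
        linarith
      have hxA' : x ∉ A := fun hx => hxA (subset_toMeasurable _ _ hx)
      -- The size condition in `A` holds because `ζ x < 2τ` and `ζ x ≤ 1/2`, so `x ∉ A` can only
      -- mean a strong signal.
      have hs : p.Cγ * ζ x ^ p.γ < signalStrength (featureSupport P) ηQ ηP x := by
        by_contra hcon
        exact hxA' ⟨not_lt.1 hcon, le_min hζτ.le h3⟩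
      obtain ⟨hxP, hsig⟩ := signalStrength_pos_imp
        (mul_nonneg p.Cγ_pos.le (Real.rpow_nonneg (hζ0 x) _)) hs
      have hfin := hP x hx (fun hx => hxG (subset_toMeasurable _ _ hx)) hxP (not_le.1 hxz) hsig
      have h8 := mul_le_mul_of_nonneg_left hfin (hζ0 x)
      rw [mul_add] at h8
      have h9 : ζ x * R' ≤ R' := mul_le_of_le_one_left hR' (by linarith)
      have h10 : ζ x * Real.exp (-(c * (|ηQ x - 1 / 2| / b) ^ (2 * p.γ))) = e x := rfl
      linarith
    have h11 := mul_le_mul_of_nonneg_left h1 (hζ0 x)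
    rw [mul_add] at h11
    have h12 : ζ x * deviationProb Q ηQ nQ kQ τ x ≤ R :=
      (mul_le_of_le_one_left h5 (by linarith)).trans h2
    exact (h11.trans (add_le_add h12 hdis)).trans (le_of_eq (by ring))
  refine hle.trans ?_
  rw [integral_const_mul, integral_add hI3 hiAi, integral_add hI2 hiGi, integral_add hI1 hei,
    integral_add (integrable_const _) hizi, setIntegral_toMeasurable, setIntegral_toMeasurable,
    integral_indicator hms]
  simp only [integral_const, probReal_univ, one_smul]
  linarith

end Risk

/-! ### Rates for the target sample. -/

lemma HolderClass.abs_sub_le {b C r : ℝ} {g : E d → ℝ} (h : HolderClass b C g) (hb : 0 ≤ b)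
    (hC : 0 ≤ C) {x y : E d} (hxy : dist y x ≤ r) : |g y - g x| ≤ C * r ^ b := by
  refine (h y x).trans ?_
  rw [← dist_eq_norm]
  gcongr

lemma rpow_const_mul_natCast_rpow {A s b : ℝ} (hA : 0 ≤ A) (n : ℕ) :
    (A * (n : ℝ) ^ s) ^ b = A ^ b * (n : ℝ) ^ (s * b) := by
  rw [Real.mul_rpow hA (by positivity), ← Real.rpow_mul (Nat.cast_nonneg n)]

lemma exists_exp_neg_natCast_rpow_le {c s : ℝ} (hc : 0 < c) (hs : 0 < s) {m : ℝ} (hm : 0 ≤ m) :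
    ∃ C : ℝ, 0 < C ∧ ∀ n : ℕ, 0 < n → Real.exp (-(c * (n : ℝ) ^ s)) ≤ C * (n : ℝ) ^ (-m) := by
  obtain ⟨C, hC, h⟩ := exists_exp_neg_rpow_le hc hs hm
  refine ⟨C, hC, fun n hn => (h n (Nat.cast_nonneg n)).trans ?_⟩
  have hn' : (0 : ℝ) < n := by exact_mod_cast hn
  exact mul_le_mul_of_nonneg_left
    (Real.rpow_le_rpow_of_nonpos hn' (by linarith) (by linarith)) hC.le

lemma tendsto_log_natCast : Tendsto (fun n : ℕ => Real.log n) atTop atTop :=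
  Real.tendsto_log_atTop.comp tendsto_natCast_atTop_atTop

/-- Deviation of the target estimate beyond the threshold. -/
lemma eventually_deviationProb_le (hd : 0 < d) (p : Params) (hβ : 0 < p.β) {cQ cτ M L : ℝ}
    (hcQ : 0 < cQ) (hcτ : 0 < cτ) (hM : 0 ≤ M) :
    ∀ᶠ nQ : ℕ in atTop, ∀ (nP : ℕ) (τ : ℝ),
      cτ * thresholdScale nQ nP (numNeighbors d cQ p.β nQ) ≤ τ →
      ∀ (Q : Measure (Obs d)) [IsProbabilityMeasure Q] (ηQ : E d → ℝ),
      IsRegressionFunction Q ηQ → HolderClass p.β p.Cβ ηQ →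
      StrongDensity (marginal Q) p.μp p.μm p.cμ p.rμ → ∀ x ∈ featureSupport Q,
      deviationProb Q ηQ nQ (numNeighbors d cQ p.β nQ) τ x ≤
        2 * (max (nQ : ℝ) nP ^ (-L) +
          Real.exp (-(M * cQ * (nQ : ℝ) ^ (2 * p.β / (2 * p.β + d))))) := by
  -- The factor 2 compensates for `k ≥ (cQ/2) n^{2β/(2β+d)}`.
  obtain ⟨A, hA, hev⟩ := exists_radius_knnEstimate_tail hd hcQ hβ (show 0 ≤ 2 * M by linarith)
    p.μm_pos p.cμ_pos p.rμ_pos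
  have hCβ := p.Cβ_pos
  -- Bias and `k^{-1/2}` are both of order `n^{-β/(2β+d)}`, so the logarithm in `τ` eventually makes
  -- the bias at most `τ/2`. The other half of `τ` absorbs the noise, with probability
  -- `exp(-kτ²/2)`, at most a power `-L` once `cτ² log ≥ 2L`.
  have hlog1 := tendsto_log_natCast.eventually_ge_atTop (2 * p.Cβ * A ^ p.β * cQ ^ (1 / 2 : ℝ) / cτ)
  have hlog2 := tendsto_log_natCast.eventually_ge_atTop (2 * L / cτ ^ 2)
  filter_upwards [hev, eventually_le_numNeighbors (d := d) hcQ hβ, eventually_gt_atTop 1,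
    hlog1, hlog2] with n hn hk hn1 hl1 hl2 nP τ hτ Q _ ηQ hreg hhol hsd x hx
  set k := numNeighbors d cQ p.β n with hkdef
  have hn0 : (0 : ℝ) < n := by exact_mod_cast (by omega : 0 < n)
  have hk0 : (0 : ℝ) < k := by exact_mod_cast hk.1
  set m : ℝ := max (n : ℝ) nP with hm
  have hm0 : 0 < m := hn0.trans_le (le_max_left _ _)
  have hlog : Real.log n ≤ Real.log m := Real.log_le_log hn0 (le_max_left _ _)
  have hlogn : 0 < Real.log n := Real.log_pos (by exact_mod_cast hn1)
  have hτ' : cτ * (Real.log m * (k : ℝ) ^ (-(1 / 2 : ℝ))) ≤ τ := hτ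
  have hbias : p.Cβ * (A * (n : ℝ) ^ (-(1 / (2 * p.β + d)))) ^ p.β ≤ τ / 2 := by
    rw [rpow_const_mul_natCast_rpow hA.le]
    have h1 : cQ ^ (-(1 / 2 : ℝ)) * (n : ℝ) ^ (-(1 / (2 * p.β + d)) * p.β) ≤
        (k : ℝ) ^ (-(1 / 2 : ℝ)) := by
      have h2 := Real.rpow_le_rpow_of_nonpos hk0 (numNeighbors_le (d := d) (b := p.β) hcQ.le n)
        (show -(1 / 2 : ℝ) ≤ 0 by norm_num)
      rw [rpow_const_mul_natCast_rpow hcQ.le] at h2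
      refine le_trans (le_of_eq ?_) h2
      congr 2
      field_simp
    have h3 : p.Cβ * A ^ p.β ≤ cτ * Real.log m * cQ ^ (-(1 / 2 : ℝ)) / 2 := by
      rw [div_le_iff₀ hcτ] at hl1
      have h4 : 2 * p.Cβ * A ^ p.β * cQ ^ (1 / 2 : ℝ) ≤ Real.log m * cτ :=
        hl1.trans (by gcongr)
      rw [Real.rpow_neg hcQ.le, ← div_eq_mul_inv, div_div, le_div_iff₀ (by positivity)]
      linarith
    have h5 : 0 ≤ (n : ℝ) ^ (-(1 / (2 * p.β + d)) * p.β) := by positivity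
    have h6 : cτ * Real.log m * (cQ ^ (-(1 / 2 : ℝ)) *
        (n : ℝ) ^ (-(1 / (2 * p.β + d)) * p.β)) ≤ τ := by
      refine le_trans ?_ hτ'
      rw [← mul_assoc cτ]
      gcongr
      exact mul_nonneg hcτ.le (by linarith)
    nlinarith [mul_le_mul_of_nonneg_right h3 h5]
  have hτ0 : 0 ≤ τ := by
    have : 0 ≤ p.Cβ * (A * (n : ℝ) ^ (-(1 / (2 * p.β + d)))) ^ p.β := by positivity
    linarith
  refine deviationProb_le fun a ha => ?_
  have htail := hn Q ηQ p.μp hreg hsd x hx a (a * ηQ x - τ / 2) (τ / 2) ha (by linarith)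
    (fun y _ hyx => by
      have h1 := abs_le.1 ((hhol.abs_sub_le p.β_mem.1 hCβ.le hyx).trans hbias)
      rcases ha with rfl | rfl <;> linarith [h1.1, h1.2])
  rw [show a * ηQ x - τ / 2 - τ / 2 = a * ηQ x - τ by ring] at htail
  refine htail.trans (add_le_add ?_ ?_)
  · rw [Real.rpow_def_of_pos hm0, Real.exp_le_exp]
    have h1 : (cτ * Real.log m) ^ 2 ≤ k * τ ^ 2 := by
      have h2 : 0 ≤ cτ * (Real.log m * (k : ℝ) ^ (-(1 / 2 : ℝ))) :=
        mul_nonneg hcτ.le (mul_nonneg (by linarith) (by positivity))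
      have h3 := pow_le_pow_left₀ h2 hτ' 2
      have h4 : ((k : ℝ) ^ (-(1 / 2 : ℝ))) ^ 2 = (k : ℝ)⁻¹ := by
        rw [← Real.rpow_natCast, ← Real.rpow_mul hk0.le, ← Real.rpow_neg_one]
        norm_num
      calc (cτ * Real.log m) ^ 2 = k * (cτ * (Real.log m * (k : ℝ) ^ (-(1 / 2 : ℝ)))) ^ 2 := by
            rw [mul_pow, mul_pow, mul_pow, h4]; field_simp
        _ ≤ k * τ ^ 2 := by gcongr
    rw [div_le_iff₀ (by positivity)] at hl2
    have h5 : 2 * L ≤ Real.log m * cτ ^ 2 := hl2.trans (by gcongr)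
    have h6 : 0 < Real.log m := by linarith
    nlinarith [mul_le_mul_of_nonneg_left h5 h6.le]
  · rw [Real.exp_le_exp]
    nlinarith [hk.2, mul_le_mul_of_nonneg_left hk.2 hM]

/-- If `β = 0`, the sample size condition bounds `n_Q`. -/
lemma eventually_not_sampleSizeCondition (hd : 0 < d) (p : Params) (hβ : p.β = 0) (cQ K : ℝ) :
    ∀ᶠ nQ : ℕ in atTop, ∀ nP : ℕ, ¬ SampleSizeCondition d p cQ K nQ nP := by
  filter_upwards [tendsto_natCast_atTop_atTop.eventually_gt_atTop (K * Real.exp cQ)]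
    with nQ hn nP h
  have hd' : (d : ℝ) ≠ 0 := by exact_mod_cast hd.ne'
  unfold SampleSizeCondition at h
  simp only [hβ, mul_zero, zero_add, div_self hd', Real.rpow_one, zero_div, Real.rpow_zero,
    mul_one, zero_mul, neg_zero] at h
  rw [Real.exp_neg, ← div_eq_mul_inv, div_le_iff₀ (Real.exp_pos _)] at h
  linarith

/-- The prefactor in `n_Q` is at least 1 and can be dropped. Raising the rest to the power `M`
yields an arbitrarily fast polynomial rate in `n_P`. -/
lemma SampleSizeCondition.exp_le {p : Params} {cQ K M : ℝ} {nQ nP : ℕ}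
    (h : SampleSizeCondition d p cQ K nQ nP) (hβ : 0 ≤ p.β) (hn : 0 < nQ) (hK : 0 ≤ K)
    (hM : 0 ≤ M) :
    Real.exp (-(M * cQ * (nQ : ℝ) ^ (2 * p.β / (2 * p.β + d)))) ≤
      K ^ M * (nP : ℝ) ^ (-(p.β * (1 + p.α) / (2 * p.γ * p.β + d) * M)) := by
  have hn1 : (1 : ℝ) ≤ nQ := by exact_mod_cast hn
  have h1 : Real.exp (-(cQ * (nQ : ℝ) ^ (2 * p.β / (2 * p.β + d)))) ≤
      K * (nP : ℝ) ^ (-(p.β * (1 + p.α) / (2 * p.γ * p.β + d))) :=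
    (le_mul_of_one_le_left (Real.exp_pos _).le (Real.one_le_rpow hn1 (by positivity))).trans h
  have h2 := Real.rpow_le_rpow (Real.exp_pos _).le h1 hM
  rw [rpow_const_mul_natCast_rpow hK, ← Real.exp_mul] at h2
  convert h2 using 2
  · ring
  · rw [neg_mul]

/-- Consequences of the choice of `k_Q` and `τ`: the deviation probability is negligible, and the
risk is bounded by the target rate. -/
lemma exists_target_bounds (hd : 0 < d) (p : Params) {cQ K cτ Cτ e : ℝ} (hcQ : 0 < cQ)
    (hβ : 0 < p.β) (hK : 0 < K) (hcτ : 0 < cτ) (hCτ : 0 < Cτ) (he : 0 ≤ e) :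
    ∃ C : ℝ, 0 < C ∧ ∀ᶠ nQ : ℕ in atTop, ∀ nP kP : ℕ, 0 < nP →
      SampleSizeCondition d p cQ K nQ nP →
      ∀ τ : ℝ, cτ * thresholdScale nQ nP (numNeighbors d cQ p.β nQ) ≤ τ →
        τ ≤ Cτ * thresholdScale nQ nP (numNeighbors d cQ p.β nQ) →
      ∀ (ε : ℝ → ℝ) (Q P : Measure (Obs d)) (ηQ ηP : E d → ℝ), NPClass p ε Q P ηQ ηP →
        0 < τ ∧
        (∀ x ∈ featureSupport Q, deviationProb Q ηQ nQ (numNeighbors d cQ p.β nQ) τ x ≤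
          C * (nP : ℝ) ^ (-e)) ∧
        expectedTabRisk Q P ηQ nQ nP (numNeighbors d cQ p.β nQ) kP τ ≤
          C * targetRate d p nQ nP := by
  have hα := p.α_nonneg
  have hγ := p.γ_pos
  have hCα := p.Cα_pos
  set e₁ := p.β * (1 + p.α) / (2 * p.γ * p.β + d) with he₁
  set e₂ := p.β * (1 + p.α) / (2 * p.β + d) with he₂
  have he₁0 : 0 < e₁ := by positivity
  have he₂0 : 0 < e₂ := by positivity
  -- Makes the sample size condition yield `n_P^{-(e+1)}`; the extra 1 keeps `M` positive when `e =
  -- 0`.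
  set M := (e + 1) / e₁ with hM
  have hM0 : 0 < M := by positivity
  -- A power `-L` of `max n_Q n_P` is then below both `n_P^{-e}` and `n_Q^{-e₂}`.
  set L := max e e₂ with hL
  obtain ⟨C₁, hC₁, hexp⟩ := exists_exp_neg_natCast_rpow_le (show 0 < M * cQ by positivity)
    (show 0 < 2 * p.β / (2 * p.β + d) by positivity) he₂0.le
  set B := 2 * Cτ * (cQ / 2) ^ (-(1 / 2 : ℝ)) with hB
  have hB0 : 0 < B := by positivity
  set C := max (2 * (1 + K ^ M)) (2 * (2 * (1 + C₁) + p.Cα * B ^ (1 + p.α))) with hC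
  refine ⟨C, by positivity, ?_⟩
  filter_upwards [eventually_deviationProb_le (L := L) hd p hβ hcQ hcτ hM0.le,
    eventually_le_numNeighbors (d := d) hcQ hβ, eventually_gt_atTop 0,
    tendsto_log_natCast.eventually_ge_atTop 1] with nQ hdev hk hn hl nP kP hnP hcond τ hτ1 hτ2
    ε Q P ηQ ηP hcl
  have := hcl.probQ
  set k := numNeighbors d cQ p.β nQ
  have hn0 : (0 : ℝ) < nQ := by exact_mod_cast hn
  have hn1 : (1 : ℝ) ≤ nQ := by exact_mod_cast hn
  have hP0 : (0 : ℝ) < nP := by exact_mod_cast hnP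
  have hP1 : (1 : ℝ) ≤ nP := by exact_mod_cast hnP
  have hk0 : (0 : ℝ) < k := by exact_mod_cast hk.1
  set m : ℝ := max (nQ : ℝ) nP with hm
  have hm0 : 0 < m := hn0.trans_le (le_max_left _ _)
  have hlogm : 1 ≤ Real.log m := hl.trans (Real.log_le_log hn0 (le_max_left _ _))
  have hτ0 : 0 < τ := by
    refine lt_of_lt_of_le ?_ hτ1
    unfold thresholdScale
    have : 0 < Real.log m := by linarith
    positivity
  have hdev' := hdev nP τ hτ1 Q ηQ hcl.regQ hcl.holderQ hcl.densityQ
  refine ⟨hτ0, fun x hx => (hdev' x hx).trans ?_, ?_⟩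
  · have h1 : m ^ (-L) ≤ (nP : ℝ) ^ (-e) :=
      (Real.rpow_le_rpow_of_nonpos hP0 (le_max_right _ _)
        (by have := he₂0.le.trans (le_max_right e e₂); linarith)).trans
        (Real.rpow_le_rpow_of_exponent_le hP1 (neg_le_neg (le_max_left _ _)))
    have h2 : Real.exp (-(M * cQ * (nQ : ℝ) ^ (2 * p.β / (2 * p.β + d)))) ≤
        K ^ M * (nP : ℝ) ^ (-e) := by
      refine (hcond.exp_le hβ.le hn hK.le hM0.le).trans ?_
      have h3 : e₁ * M = e + 1 := by rw [hM]; field_simp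
      rw [h3]
      gcongr
      linarith
    have h4 : 0 ≤ (nP : ℝ) ^ (-e) := by positivity
    calc _ ≤ 2 * ((nP : ℝ) ^ (-e) + K ^ M * (nP : ℝ) ^ (-e)) := by gcongr
      _ = 2 * (1 + K ^ M) * (nP : ℝ) ^ (-e) := by ring
      _ ≤ C * (nP : ℝ) ^ (-e) := by gcongr; exact le_max_left _ _
  · refine (hcl.expectedTabRisk_le_target hτ0 hdev').trans ?_
    set T := targetRate d p nQ nP with hT
    have hTdef : T = Real.log m ^ (1 + p.α) * (nQ : ℝ) ^ (-e₂) := rfl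
    have hnT : (nQ : ℝ) ^ (-e₂) ≤ T := by
      rw [hTdef]
      exact le_mul_of_one_le_left (by positivity) (Real.one_le_rpow hlogm (by linarith))
    have hT0 : 0 ≤ T := le_trans (by positivity) hnT
    have h1 : m ^ (-L) ≤ T := by
      refine le_trans ?_ hnT
      exact (Real.rpow_le_rpow_of_nonpos hn0 (le_max_left _ _)
        (by have := he₂0.le.trans (le_max_right e e₂); linarith)).trans
        (Real.rpow_le_rpow_of_exponent_le hn1 (neg_le_neg (le_max_right _ _)))
    have h2 : Real.exp (-(M * cQ * (nQ : ℝ) ^ (2 * p.β / (2 * p.β + d)))) ≤ C₁ * T :=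
      (hexp nQ hn).trans (by gcongr)
    have h3 : (2 * τ) ^ (1 + p.α) ≤ B ^ (1 + p.α) * T := by
      have h4 : 2 * τ ≤ B * (Real.log m * (nQ : ℝ) ^ (-(p.β / (2 * p.β + d)))) := by
        have h5 : (k : ℝ) ^ (-(1 / 2 : ℝ)) ≤
            (cQ / 2) ^ (-(1 / 2 : ℝ)) * (nQ : ℝ) ^ (-(p.β / (2 * p.β + d))) := by
          have h6 := Real.rpow_le_rpow_of_nonpos (by positivity) hk.2
            (show -(1 / 2 : ℝ) ≤ 0 by norm_num)
          rw [rpow_const_mul_natCast_rpow (by positivity)] at h6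
          refine h6.trans (le_of_eq ?_)
          congr 2
          field_simp
        have h7 : Cτ * thresholdScale nQ nP k ≤ Cτ * (Real.log m *
            ((cQ / 2) ^ (-(1 / 2 : ℝ)) * (nQ : ℝ) ^ (-(p.β / (2 * p.β + d))))) := by
          unfold thresholdScale
          have : 0 ≤ Real.log m := by linarith
          gcongr
        rw [hB]
        linarith
      refine (Real.rpow_le_rpow (by positivity) h4 (by linarith)).trans (le_of_eq ?_)
      have : 0 ≤ Real.log m := by linarith
      rw [Real.mul_rpow hB0.le (by positivity), Real.mul_rpow this (by positivity), hTdef,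
        ← Real.rpow_mul hn0.le]
      congr 3
      rw [he₂]
      ring
    calc _ ≤ 2 * (2 * (T + C₁ * T) + p.Cα * (B ^ (1 + p.α) * T)) := by gcongr
      _ = 2 * (2 * (1 + C₁) + p.Cα * B ^ (1 + p.α)) * T := by ring
      _ ≤ C * T := by gcongr; exact le_max_right _ _

/-! ### Signal carried by the source neighbours, and the resulting bounds. -/

/-- Error probability of the source estimate at a point where all neighbours carry a signal of
order `|η - 1/2|^γ`. -/
lemma exists_radius_disagreeProb_le (hd : 0 < d) {c b γ μm cμ rμ : ℝ} (hc : 0 < c) (hb : 0 < b)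
    (hγ : 0 < γ) (hμm : 0 < μm) (hcμ : 0 < cμ) (hrμ : 0 < rμ) :
    ∃ A : ℝ, 0 < A ∧ ∀ e : ℝ, 0 ≤ e → ∃ C : ℝ, 0 < C ∧ ∀ᶠ n : ℕ in atTop,
      ∀ (P : Measure (Obs d)) [IsProbabilityMeasure P] (ηQ ηP : E d → ℝ) (μp : ℝ),
      IsRegressionFunction P ηP → StrongDensity (marginal P) μp μm cμ rμ →
      ∀ x ∈ featureSupport P, ∀ w : ℝ, 0 ≤ w → 0 < |ηQ x - 1 / 2| →
      (∀ y ∈ featureSupport P, dist y x ≤ A * (n : ℝ) ^ (-(1 / (2 * b + d))) →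
        w * |ηQ x - 1 / 2| ^ γ ≤ Real.sign (ηQ x - 1 / 2) * (ηP y - 1 / 2)) →
      disagreeProb P ηQ n (numNeighbors d c b n) x ≤
        Real.exp (-(c * w ^ 2 * (|ηQ x - 1 / 2| / (n : ℝ) ^ (-(b / γ / (2 * b + d)))) ^ (2 * γ))) +
          C * (n : ℝ) ^ (-e) := by
  obtain ⟨A, hA, hev⟩ := exists_radius_knnEstimate_tail hd hc hb zero_le_one hμm hcμ hrμ
  refine ⟨A, hA, fun e he => ?_⟩
  obtain ⟨C, hC, hexp⟩ := exists_exp_neg_natCast_rpow_le (show 0 < c / 2 by positivity)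
    (show 0 < 2 * b / (2 * b + d) by positivity) he
  refine ⟨C, hC, ?_⟩
  filter_upwards [hev, eventually_le_numNeighbors (d := d) hc hb, eventually_gt_atTop 0]
    with n hn hk hn0 P _ ηQ ηP μp hreg hsd x hx w hw hζ hsig
  have hn0' : (0 : ℝ) < n := by exact_mod_cast hn0
  set ζ := |ηQ x - 1 / 2| with hζdef
  set a := Real.sign (ηQ x - 1 / 2) with ha
  -- The deviation `t` equals the whole signal, so the tail event is exactly that the vote reaches
  -- or crosses 1/2.
  have htail := hn P ηP μp hreg hsd x hx a (a * (1 / 2) + w * ζ ^ γ) (w * ζ ^ γ)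
    (sign_eq_one_or hζ) (by positivity) (fun y hy hyx => by linarith [hsig y hy hyx])
  rw [add_sub_cancel_right] at htail
  refine (disagreeProb_le hζ htail).trans (add_le_add ?_ ?_)
  · rw [Real.exp_le_exp, Real.div_rpow hζ.le (by positivity), ← Real.rpow_mul hn0'.le]
    have h1 : -(b / γ / (2 * b + d)) * (2 * γ) = -(2 * b / (2 * b + d)) := by field_simp
    have h2 : (ζ ^ γ) ^ 2 = ζ ^ (2 * γ) := by
      rw [← Real.rpow_natCast, ← Real.rpow_mul hζ.le]; congr 1; push_cast; ring
    rw [h1, Real.rpow_neg hn0'.le, div_inv_eq_mul, mul_pow, h2]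
    have h3 : 0 ≤ w ^ 2 * ζ ^ (2 * γ) := by positivity
    nlinarith [mul_le_mul_of_nonneg_right hk.2 h3]
  · refine le_trans (Real.exp_le_exp.2 ?_) (hexp n hn0)
    linarith [hk.2]

lemma NPClass.ambiguityAt_nonneg {p : Params} {ε : ℝ → ℝ} {Q P : Measure (Obs d)}
    {ηQ ηP : E d → ℝ} (h : NPClass p ε Q P ηQ ηP) {τ : ℝ} (hτ : 0 ≤ τ) : 0 ≤ ambiguityAt ε τ :=
  (integral_nonneg fun _ => abs_nonneg _).trans
    (h.ambiguity.bound _ ⟨le_min (by linarith) (by norm_num), min_le_right _ _⟩)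

/-- The strong signal at a neighbour `y` of `x` has the sign of `ηQ x - 1/2` and is of order
`|ηQ x - 1/2|^γ`, if `ηQ y` is close to `ηQ x`. -/
lemma signal_of_mem_strongSignal {Ω ΩP : Set (E d)} {ηQ ηP : E d → ℝ} {γ Cγ : ℝ} (hγ : 0 < γ)
    (hCγ : 0 < Cγ) {x y : E d} (hy : y ∈ strongSignal Ω ΩP ηQ ηP γ Cγ)
    (hx : 0 < |ηQ x - 1 / 2|) (hxy : |ηQ y - ηQ x| ≤ |ηQ x - 1 / 2| / 2) :
    Cγ * (1 / 2) ^ γ * |ηQ x - 1 / 2| ^ γ ≤ Real.sign (ηQ x - 1 / 2) * (ηP y - 1 / 2) := by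
  have hζ : |ηQ x - 1 / 2| / 2 ≤ |ηQ y - 1 / 2| := by
    have := abs_sub_abs_le_abs_sub (ηQ x - 1 / 2) (ηQ y - 1 / 2)
    rw [show ηQ x - 1 / 2 - (ηQ y - 1 / 2) = -(ηQ y - ηQ x) by ring, abs_neg] at this
    linarith
  have hsign : Real.sign (ηQ y - 1 / 2) = Real.sign (ηQ x - 1 / 2) := by
    have h1 := abs_le.1 hxy
    rcases lt_or_gt_of_ne (abs_pos.1 hx) with h2 | h2
    · rw [abs_of_neg h2] at h1
      rw [Real.sign_of_neg h2, Real.sign_of_neg (by linarith [h1.1, h1.2])]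
    · rw [abs_of_pos h2] at h1
      rw [Real.sign_of_pos h2, Real.sign_of_pos (by linarith [h1.1, h1.2])]
  have hle : Cγ * (1 / 2) ^ γ * |ηQ x - 1 / 2| ^ γ ≤ signalStrength ΩP ηQ ηP y := by
    refine le_trans ?_ hy.2
    rw [mul_assoc, ← Real.mul_rpow (by norm_num) hx.le]
    gcongr
    linarith
  have hpos : 0 < Cγ * (1 / 2) ^ γ * |ηQ x - 1 / 2| ^ γ := by positivity
  -- `signalStrength_pos_imp` needs a strict inequality, so the bound is obtained from all `v` below
  -- the target value.
  refine le_of_forall_lt fun v hv => ?_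
  rw [← hsign]
  rcases le_or_gt 0 v with h0 | h0
  · exact (signalStrength_pos_imp h0 (hv.trans_le hle)).2
  · exact h0.trans ((signalStrength_pos_imp le_rfl (hpos.trans_le hle)).2)

/-- The signal persists in a ball on which the bias of the source is at most half of it. -/
lemma signal_of_holder {ηQ ηP : E d → ℝ} {b Cb r s : ℝ} (hP : HolderClass b Cb ηP) (hb : 0 ≤ b)
    (hCb : 0 ≤ Cb) {x y : E d} (hx : 0 < |ηQ x - 1 / 2|) (hyx : dist y x ≤ r)
    (hs : s < Real.sign (ηQ x - 1 / 2) * (ηP x - 1 / 2)) (hr : 2 * (Cb * r ^ b) ≤ s) :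
    s / 2 ≤ Real.sign (ηQ x - 1 / 2) * (ηP y - 1 / 2) := by
  have h1 := abs_le.1 (hP.abs_sub_le hb hCb hyx)
  rcases sign_eq_one_or hx with h2 | h2 <;> rw [h2] at hs ⊢ <;> linarith [h1.1, h1.2]

lemma min_mul_le {C a T : ℝ} (hC : 0 ≤ C) {r : ℝ} (h1 : r ≤ C * a) (h2 : r ≤ C * T) :
    r ≤ C * min a T := by
  rw [mul_min_of_nonneg _ _ hC]
  exact le_min h1 h2

lemma targetRate_nonneg (p : Params) {nQ nP : ℕ} (hn : 0 < nQ) : 0 ≤ targetRate d p nQ nP := by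
  unfold targetRate
  have : (1 : ℝ) ≤ max (nQ : ℝ) nP := le_max_of_le_left (by exact_mod_cast hn)
  have := Real.log_nonneg this
  positivity

lemma boundaryRisk_nonneg (p : Params) (Q P : Measure (Obs d)) (ηQ ηP : E d → ℝ) (cb : ℝ)
    (nP : ℕ) : 0 ≤ boundaryRisk p Q P ηQ ηP cb nP := integral_nonneg fun _ => abs_nonneg _

/-- The boundary risk is at most of the order given by the margin assumption. -/
lemma NPClass.boundaryRisk_le {p : Params} {ε : ℝ → ℝ} {Q P : Measure (Obs d)}
    {ηQ ηP : E d → ℝ} (h : NPClass p ε Q P ηQ ηP) {cb : ℝ} (hcb : 0 < cb) {nP : ℕ}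
    (hn : 0 < nP) :
    boundaryRisk p Q P ηQ ηP cb nP ≤ p.Cα * cb ^ (1 + p.α) *
      (nP : ℝ) ^ (-(p.βP * (1 + p.α) / p.γ / (2 * p.γ * p.β + d))) := by
  have := h.probQ
  have hn' : (0 : ℝ) < nP := by exact_mod_cast hn
  set z := cb * (nP : ℝ) ^ (-(p.βP / p.γ / (2 * p.γ * p.β + d))) with hz
  have hz0 : 0 < z := by positivity
  have hint := integrable_abs_sub_half (ν := marginal Q) h.regQ.measurable h.regQ.mem_Icc
  calc boundaryRisk p Q P ηQ ηP cb nP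
      ≤ ∫ x in {x | |ηQ x - 1 / 2| ≤ z}, |ηQ x - 1 / 2| ∂(marginal Q) :=
        integral_mono_measure (Measure.restrict_mono (fun x hx => hx.2.1) le_rfl)
          (ae_of_all _ fun _ => abs_nonneg _) hint.integrableOn
    _ ≤ p.Cα * z ^ (1 + p.α) := h.margin.setIntegral_le h.regQ.measurable h.regQ.mem_Icc hz0
    _ = _ := by
        rw [hz, rpow_const_mul_natCast_rpow hcb.le, ← mul_assoc]
        congr 2
        ring

/-- The constant relating the first bound to the second one. -/
lemma min_boundary_le {C₀ a b e ε' T : ℝ} (hC₀ : 0 ≤ C₀) (hab : a ≤ b)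
    (he : e ≤ C₀ * b) (hε : 0 ≤ ε') (hT : 0 ≤ T) :
    min (a + e + ε') T ≤ (1 + C₀) * min (b + ε') T := by
  refine min_mul_le (by linarith) ((min_le_left _ _).trans ?_) ((min_le_right _ _).trans ?_)
  · nlinarith
  · nlinarith

/-- The bound by the source sample in the regime `β_P ≤ γβ`. -/
lemma exists_source_bound_boundary (hd : 0 < d) (p : Params) {cP : ℝ} (hcP : 0 < cP)
    (hβ : 0 < p.β) :
    ∃ cb : ℝ, 0 < cb ∧ ∀ C₁ : ℝ, 0 < C₁ → ∃ C : ℝ, 0 < C ∧ ∀ᶠ nP : ℕ in atTop,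
      ∀ (ε : ℝ → ℝ) (nQ kQ : ℕ) (τ : ℝ) (Q P : Measure (Obs d)) (ηQ ηP : E d → ℝ), 0 ≤ τ →
      NPClass p ε Q P ηQ ηP →
      (∀ x ∈ featureSupport Q, deviationProb Q ηQ nQ kQ τ x ≤
        C₁ * (nP : ℝ) ^ (-(p.β * (1 + p.α) / (2 * p.γ * p.β + d)))) →
      expectedTabRisk Q P ηQ nQ nP kQ (numNeighbors d cP (p.γ * p.β) nP) τ ≤
        C * ((nP : ℝ) ^ (-(p.β * (1 + p.α) / (2 * p.γ * p.β + d))) +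
          boundaryRisk p Q P ηQ ηP cb nP + ambiguityAt ε τ) := by
  have hα := p.α_nonneg
  have hγ := p.γ_pos
  have hCα := p.Cα_pos
  have hCγ := p.Cγ_pos
  have hCβ := p.Cβ_pos
  have hCβP := p.CβP_pos
  have hβP := p.βP_mem.1
  set D := 2 * p.γ * p.β + d with hD
  have hD0 : 0 < D := by positivity
  have hD' : 2 * (p.γ * p.β) + d = D := by rw [hD]; ring
  set e := p.β * (1 + p.α) / D with he
  obtain ⟨A, hA, hsource⟩ := exists_radius_disagreeProb_le (b := p.γ * p.β) hd hcP (by positivity)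
    hγ p.μm_pos p.cμ_pos p.rμ_pos
  obtain ⟨C₂, hC₂, hev⟩ := hsource e (by positivity)
  -- The first entry is the signal left after the bias of `ηP`; the second is the one inherited from
  -- neighbours in `Ω⁺`, whose margin is at least half that of `x`.
  set w := min (p.Cγ / 2) (p.Cγ * (1 / 2) ^ p.γ) with hw
  have hw0 : 0 < w := by positivity
  obtain ⟨C₃, hC₃, hpeel⟩ := exists_integral_mul_exp_le (d := d)
    (show 0 < cP * w ^ 2 by positivity) hγ hα hCα
  -- `cb ≥ A` puts every neighbour in the ball defining `Ω^b`. The other entry makes the bias of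
  -- `ηP` at most half the signal when `ζ > cb n_P^{-(βP/γ)/D}`. Neither involves `C₁`, through
  -- which `K, cτ, Cτ` enter.
  set cb := max A ((2 * p.CβP * A ^ p.βP / p.Cγ) ^ (1 / p.γ)) with hcb
  have hcb0 : 0 < cb := by positivity
  have hcbγ : 2 * (p.CβP * A ^ p.βP) ≤ p.Cγ * cb ^ p.γ := by
    have h1 := Real.rpow_le_rpow (by positivity) (le_max_right A
      ((2 * p.CβP * A ^ p.βP / p.Cγ) ^ (1 / p.γ))) hγ.le
    rw [← Real.rpow_mul (by positivity), one_div_mul_cancel hγ.ne', Real.rpow_one,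
      div_le_iff₀' hCγ] at h1
    linarith
  refine ⟨cb, hcb0, fun C₁ hC₁ => ?_⟩
  -- Then `ηQ` varies by at most `Bh/2` among the neighbours, less than half the margin when `ζ >
  -- Bh`.
  set B := 2 * p.Cβ * A ^ p.β with hB
  refine ⟨2 * (1 + C₁ + C₂ + p.Cα * B ^ (1 + p.α) + C₃), by positivity, ?_⟩
  filter_upwards [hev, eventually_gt_atTop 0] with nP hn hn0 ε nQ kQ τ Q P ηQ ηP hτ hcl hdev
  have := hcl.probQ
  have := hcl.probP
  have hn' : (0 : ℝ) < nP := by exact_mod_cast hn0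
  rw [hD'] at hn
  set h := (nP : ℝ) ^ (-(p.β / D)) with hh
  have hh0 : 0 < h := by positivity
  have hexpo : -(p.γ * p.β / p.γ / D) = -(p.β / D) := by field_simp
  rw [hexpo] at hn
  set H := (nP : ℝ) ^ (-e) with hH
  have hH0 : 0 < H := by positivity
  have hhH : h ^ (1 + p.α) = H := by
    rw [hh, hH, ← Real.rpow_mul hn'.le]
    congr 1
    rw [he]; ring
  have hmain := hcl.expectedTabRisk_le_source (kP := numNeighbors d cP (p.γ * p.β) nP)
    (nP := nP) (z := B * h) (R' := C₂ * H) (b := h) hτ (by positivity)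
    (show 0 ≤ cP * w ^ 2 by positivity) hh0
    (boundarySet p (featureSupport Q) (featureSupport P) ηQ ηP cb nP) hdev (by positivity)
    (hpeel (marginal Q) ηQ hcl.margin hcl.regQ.measurable h hh0)
    (by
      intro x hxQ hxG hxP hxz hsig
      have hζ : 0 < |ηQ x - 1 / 2| := lt_trans (by positivity) hxz
      refine hn P ηQ ηP p.μp hcl.regP hcl.densityP x hxP w hw0.le hζ fun y hy hyx => ?_
      by_cases hball : Metric.closedBall x (cb * (nP : ℝ) ^ (-(1 / D))) ∩ featureSupport P ⊆
          strongSignal (featureSupport Q) (featureSupport P) ηQ ηP p.γ p.Cγ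
      · have hyball : y ∈ Metric.closedBall x (cb * (nP : ℝ) ^ (-(1 / D))) :=
          hyx.trans (by gcongr; exact le_max_left _ _)
        have hclose := hcl.holderQ.abs_sub_le p.β_mem.1 hCβ.le hyx
        rw [rpow_const_mul_natCast_rpow hA.le] at hclose
        have hexp2 : -(1 / D) * p.β = -(p.β / D) := by ring
        rw [hexp2] at hclose
        have hclose' : |ηQ y - ηQ x| ≤ |ηQ x - 1 / 2| / 2 := by
          rw [hB] at hxz
          linarith
        refine le_trans ?_ (signal_of_mem_strongSignal hγ hCγ (hball ⟨hyball, hy⟩) hζ hclose')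
        gcongr
        exact min_le_right _ _
      · have hlarge : cb * (nP : ℝ) ^ (-(p.βP / p.γ / D)) < |ηQ x - 1 / 2| := by
          by_contra hcon
          exact hxG ⟨hxQ, not_lt.1 hcon, hball⟩
        have h1 : 2 * (p.CβP * (A * (nP : ℝ) ^ (-(1 / D))) ^ p.βP) ≤
            p.Cγ * |ηQ x - 1 / 2| ^ p.γ := by
          have h2 := Real.rpow_le_rpow (by positivity) hlarge.le hγ.le
          rw [rpow_const_mul_natCast_rpow hcb0.le] at h2
          rw [rpow_const_mul_natCast_rpow hA.le]
          have h3 : -(p.βP / p.γ / D) * p.γ = -(1 / D) * p.βP := by field_simp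
          rw [h3] at h2
          have h4 : 0 ≤ (nP : ℝ) ^ (-(1 / D) * p.βP) := by positivity
          nlinarith [mul_le_mul_of_nonneg_right hcbγ h4, mul_le_mul_of_nonneg_left h2 hCγ.le]
        refine le_trans ?_ (signal_of_holder hcl.holderP hβP hCβP.le hζ hyx hsig h1)
        rw [mul_div_right_comm]
        gcongr
        exact min_le_left _ _)
  refine hmain.trans ?_
  rw [Real.mul_rpow (by positivity) hh0.le, hhH]
  have hb0 := boundaryRisk_nonneg p Q P ηQ ηP cb nP
  have ha0 := hcl.ambiguityAt_nonneg hτ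
  have hbr : ∫ x in boundarySet p (featureSupport Q) (featureSupport P) ηQ ηP cb nP,
    |ηQ x - 1 / 2| ∂(marginal Q) = boundaryRisk p Q P ηQ ηP cb nP := rfl
  rw [hbr]
  set S := C₁ + C₂ + p.Cα * B ^ (1 + p.α) + C₃ with hS
  have hS0 : 0 ≤ S := by positivity
  have h1 := mul_nonneg hS0 hb0
  have h2 := mul_nonneg hS0 ha0
  calc _ = 2 * (S * H + boundaryRisk p Q P ηQ ηP cb nP + ambiguityAt ε τ) := by rw [hS]; ring
    _ ≤ 2 * (1 + S) * (H + boundaryRisk p Q P ηQ ηP cb nP + ambiguityAt ε τ) := by nlinarith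
    _ = _ := by rw [hS]; ring

/-- The bound by the source sample in the regime `γβ < β_P`. -/
lemma exists_source_bound (hd : 0 < d) (p : Params) {cP : ℝ} (hcP : 0 < cP) (hβP : 0 < p.βP)
    {C₁ : ℝ} (hC₁ : 0 < C₁) :
    ∃ C : ℝ, 0 < C ∧ ∀ᶠ nP : ℕ in atTop,
      ∀ (ε : ℝ → ℝ) (nQ kQ : ℕ) (τ : ℝ) (Q P : Measure (Obs d)) (ηQ ηP : E d → ℝ), 0 ≤ τ →
      NPClass p ε Q P ηQ ηP →
      (∀ x ∈ featureSupport Q, deviationProb Q ηQ nQ kQ τ x ≤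
        C₁ * (nP : ℝ) ^ (-(p.βP * (1 + p.α) / p.γ / (2 * p.βP + d)))) →
      expectedTabRisk Q P ηQ nQ nP kQ (numNeighbors d cP p.βP nP) τ ≤
        C * ((nP : ℝ) ^ (-(p.βP * (1 + p.α) / p.γ / (2 * p.βP + d))) + ambiguityAt ε τ) := by
  have hα := p.α_nonneg
  have hγ := p.γ_pos
  have hCα := p.Cα_pos
  have hCγ := p.Cγ_pos
  have hCβP := p.CβP_pos
  set D := 2 * p.βP + d with hD
  have hD0 : 0 < D := by positivity
  set e := p.βP * (1 + p.α) / p.γ / D with he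
  obtain ⟨A, hA, hsource⟩ := exists_radius_disagreeProb_le hd hcP hβP
    hγ p.μm_pos p.cμ_pos p.rμ_pos
  obtain ⟨C₂, hC₂, hev⟩ := hsource e (by positivity)
  set w := p.Cγ / 2 with hw
  have hw0 : 0 < w := by positivity
  obtain ⟨C₃, hC₃, hpeel⟩ := exists_integral_mul_exp_le (d := d)
    (show 0 < cP * w ^ 2 by positivity) hγ hα hCα
  -- Solves `Cγ (Bh)^γ = 2 CβP (A n_P^{-1/D})^{βP}`: the margin at which the signal is twice the
  -- bias of `ηP`. No exceptional set is needed.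
  set B := (2 * p.CβP * A ^ p.βP / p.Cγ) ^ (1 / p.γ) with hB
  have hB0 : 0 < B := by positivity
  have hBγ : p.Cγ * B ^ p.γ = 2 * (p.CβP * A ^ p.βP) := by
    rw [hB, ← Real.rpow_mul (by positivity), one_div_mul_cancel hγ.ne', Real.rpow_one]
    field_simp
  refine ⟨2 * (1 + C₁ + C₂ + p.Cα * B ^ (1 + p.α) + C₃), by positivity, ?_⟩
  filter_upwards [hev, eventually_gt_atTop 0] with nP hn hn0 ε nQ kQ τ Q P ηQ ηP hτ hcl hdev
  have := hcl.probQ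
  have := hcl.probP
  have hn' : (0 : ℝ) < nP := by exact_mod_cast hn0
  set h := (nP : ℝ) ^ (-(p.βP / p.γ / D)) with hh
  have hh0 : 0 < h := by positivity
  set H := (nP : ℝ) ^ (-e) with hH
  have hH0 : 0 < H := by positivity
  have hhH : h ^ (1 + p.α) = H := by
    rw [hh, hH, ← Real.rpow_mul hn'.le]
    congr 1
    rw [he]; ring
  have hmain := hcl.expectedTabRisk_le_source (kP := numNeighbors d cP p.βP nP)
    (nP := nP) (z := B * h) (R' := C₂ * H) (b := h) hτ (by positivity)
    (show 0 ≤ cP * w ^ 2 by positivity) hh0 ∅ hdev (by positivity)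
    (hpeel (marginal Q) ηQ hcl.margin hcl.regQ.measurable h hh0)
    (by
      intro x hxQ _ hxP hxz hsig
      have hζ : 0 < |ηQ x - 1 / 2| := lt_trans (by positivity) hxz
      refine hn P ηQ ηP p.μp hcl.regP hcl.densityP x hxP w hw0.le hζ fun y hy hyx => ?_
      have h1 : 2 * (p.CβP * (A * (nP : ℝ) ^ (-(1 / D))) ^ p.βP) ≤
          p.Cγ * |ηQ x - 1 / 2| ^ p.γ := by
        have h2 := Real.rpow_le_rpow (by positivity) hxz.le hγ.le
        rw [hh, rpow_const_mul_natCast_rpow hB0.le] at h2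
        rw [rpow_const_mul_natCast_rpow hA.le]
        have h3 : -(p.βP / p.γ / D) * p.γ = -(1 / D) * p.βP := by field_simp
        rw [h3] at h2
        calc _ = p.Cγ * B ^ p.γ * (nP : ℝ) ^ (-(1 / D) * p.βP) := by rw [hBγ]; ring
          _ = p.Cγ * (B ^ p.γ * (nP : ℝ) ^ (-(1 / D) * p.βP)) := by ring
          _ ≤ _ := by gcongr
      refine le_trans (le_of_eq ?_)
        (signal_of_holder hcl.holderP hβP.le hCβP.le hζ hyx hsig h1)
      rw [hw]; ring)
  refine hmain.trans ?_
  rw [Real.mul_rpow (by positivity) hh0.le, hhH, Measure.restrict_empty, integral_zero_measure]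
  have ha0 := hcl.ambiguityAt_nonneg hτ
  set S := C₁ + C₂ + p.Cα * B ^ (1 + p.α) + C₃ with hS
  have hS0 : 0 ≤ S := by positivity
  have h2 := mul_nonneg hS0 ha0
  calc _ = 2 * (S * H + ambiguityAt ε τ) := by rw [hS]; ring
    _ ≤ 2 * (1 + S) * (H + ambiguityAt ε τ) := by nlinarith
    _ = _ := by rw [hS]; ring

end TransferKNN

/-! ### Assembly of the two regimes. -/

open TransferKNN Filter in
theorem mainTheorem9 {d : ℕ} (hd : 0 < d) (p : TransferKNN.Params) (ε : ℝ → ℝ)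
    (cQ cP : ℝ) (hcQ : 0 < cQ) (hcP : 0 < cP) :
    -- the regime `γβ ≥ β_P`, with `k_P = ⌊c_P n_P^{2γβ/(2γβ+d)}⌋`
    (p.βP ≤ p.γ * p.β →
      ∃ cb : ℝ, 0 < cb ∧
      ∀ K cτ Cτ : ℝ, 0 < K → 0 < cτ → 0 < Cτ →
      ∃ C : ℝ, 0 < C ∧ ∃ N : ℕ, ∀ nQ nP kQ kP : ℕ, N ≤ nQ → N ≤ nP →
        TransferKNN.SampleSizeCondition d p cQ K nQ nP →
        kQ = TransferKNN.numNeighbors d cQ p.β nQ →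
        kP = TransferKNN.numNeighbors d cP (p.γ * p.β) nP →
        ∀ τ : ℝ, cτ * TransferKNN.thresholdScale nQ nP kQ ≤ τ →
          τ ≤ Cτ * TransferKNN.thresholdScale nQ nP kQ →
        ∀ (Q P : MeasureTheory.Measure (TransferKNN.Obs d)) (ηQ ηP : TransferKNN.E d → ℝ),
          TransferKNN.NPClass p ε Q P ηQ ηP →
          MeasureTheory.Integrable (TransferKNN.tabExcessRisk Q ηQ kQ kP τ)
            (TransferKNN.sampleLaw Q P nQ nP) ∧
          TransferKNN.expectedTabRisk Q P ηQ nQ nP kQ kP τ ≤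
            C * min ((nP : ℝ) ^ (-(p.β * (1 + p.α) / (2 * p.γ * p.β + d))) +
                  TransferKNN.boundaryRisk p Q P ηQ ηP cb nP + TransferKNN.ambiguityAt ε τ)
                (TransferKNN.targetRate d p nQ nP) ∧
          min ((nP : ℝ) ^ (-(p.β * (1 + p.α) / (2 * p.γ * p.β + d))) +
                  TransferKNN.boundaryRisk p Q P ηQ ηP cb nP + TransferKNN.ambiguityAt ε τ)
                (TransferKNN.targetRate d p nQ nP) ≤
            C * min ((nP : ℝ) ^ (-(p.βP * (1 + p.α) / p.γ / (2 * p.γ * p.β + d))) +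
                  TransferKNN.ambiguityAt ε τ)
                (TransferKNN.targetRate d p nQ nP)) ∧
    -- the regime `γβ < β_P`, with `k_P = ⌊c_P n_P^{2β_P/(2β_P+d)}⌋`
    (p.γ * p.β < p.βP →
      ∀ K cτ Cτ : ℝ, 0 < K → 0 < cτ → 0 < Cτ →
      ∃ C : ℝ, 0 < C ∧ ∃ N : ℕ, ∀ nQ nP kQ kP : ℕ, N ≤ nQ → N ≤ nP →
        TransferKNN.SampleSizeCondition d p cQ K nQ nP →
        kQ = TransferKNN.numNeighbors d cQ p.β nQ →
        kP = TransferKNN.numNeighbors d cP p.βP nP →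
        ∀ τ : ℝ, cτ * TransferKNN.thresholdScale nQ nP kQ ≤ τ →
          τ ≤ Cτ * TransferKNN.thresholdScale nQ nP kQ →
        ∀ (Q P : MeasureTheory.Measure (TransferKNN.Obs d)) (ηQ ηP : TransferKNN.E d → ℝ),
          TransferKNN.NPClass p ε Q P ηQ ηP →
          MeasureTheory.Integrable (TransferKNN.tabExcessRisk Q ηQ kQ kP τ)
            (TransferKNN.sampleLaw Q P nQ nP) ∧
          TransferKNN.expectedTabRisk Q P ηQ nQ nP kQ kP τ ≤
            C * min ((nP : ℝ) ^ (-(p.βP * (1 + p.α) / p.γ / (2 * p.βP + d))) +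
                  TransferKNN.ambiguityAt ε τ)
                (TransferKNN.targetRate d p nQ nP)) := by
  have hα := p.α_nonneg
  have hγ := p.γ_pos
  have hCα := p.Cα_pos
  have hβ0 : 0 ≤ p.β := p.β_mem.1
  have hβP0 : 0 ≤ p.βP := p.βP_mem.1
  have hvac : p.β = 0 → ∀ K : ℝ, ∃ N : ℕ, ∀ nQ : ℕ, N ≤ nQ → ∀ nP : ℕ,
      ¬ SampleSizeCondition d p cQ K nQ nP := fun h K =>
    eventually_atTop.1 (eventually_not_sampleSizeCondition hd p h cQ K)
  refine ⟨fun hreg => ?_, fun hreg K cτ Cτ hK hcτ hCτ => ?_⟩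
  -- For `β = 0` the sample size condition fails for all large `n_Q`, so the claim is vacuous.
  · rcases hβ0.eq_or_lt with hβ | hβ
    · refine ⟨1, one_pos, fun K cτ Cτ _ _ _ => ?_⟩
      obtain ⟨N, hN⟩ := hvac hβ.symm K
      exact ⟨1, one_pos, N, fun nQ nP _ _ hnQ _ hcond => absurd hcond (hN nQ hnQ nP)⟩
    obtain ⟨cb, hcb, hsource⟩ := exists_source_bound_boundary hd p hcP hβ
    refine ⟨cb, hcb, fun K cτ Cτ hK hcτ hCτ => ?_⟩
    obtain ⟨C₁, hC₁, hev₁⟩ := exists_target_bounds hd p hcQ hβ hK hcτ hCτ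
      (show 0 ≤ p.β * (1 + p.α) / (2 * p.γ * p.β + d) by positivity)
    obtain ⟨C₂, hC₂, hev₂⟩ := hsource C₁ hC₁
    obtain ⟨N₁, hN₁⟩ := eventually_atTop.1 hev₁
    obtain ⟨N₂, hN₂⟩ := eventually_atTop.1 hev₂
    set C₃ := p.Cα * cb ^ (1 + p.α) with hC₃
    have hC₃0 : 0 ≤ C₃ := by positivity
    set C := max (max C₁ C₂) (1 + C₃) with hC
    have hC0 : 0 ≤ C := le_max_of_le_right (by linarith)
    refine ⟨C, lt_max_of_lt_right (by linarith), max 1 (max N₁ N₂), ?_⟩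
    rintro nQ nP kQ kP hnQ hnP hcond rfl rfl τ hτ1 hτ2 Q P ηQ ηP hcl
    have hnQ1 : 0 < nQ := lt_of_lt_of_le one_pos ((le_max_left _ _).trans hnQ)
    have hnP1 : 0 < nP := lt_of_lt_of_le one_pos ((le_max_left _ _).trans hnP)
    obtain ⟨hτ, hdev, htarget⟩ := hN₁ nQ (((le_max_left _ _).trans (le_max_right _ _)).trans hnQ)
      nP (numNeighbors d cP (p.γ * p.β) nP) hnP1 hcond τ hτ1 hτ2 ε Q P ηQ ηP hcl
    have hsrc := hN₂ nP (((le_max_right _ _).trans (le_max_right _ _)).trans hnP) ε nQ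
      (numNeighbors d cQ p.β nQ) τ Q P ηQ ηP hτ.le hcl hdev
    have hT := targetRate_nonneg (d := d) p (nP := nP) hnQ1
    have ha := hcl.ambiguityAt_nonneg hτ.le
    have hb := boundaryRisk_nonneg p Q P ηQ ηP cb nP
    have hnP1' : (1 : ℝ) ≤ nP := by exact_mod_cast hnP1
    have := hcl.probQ
    have := hcl.probP
    refine ⟨integrable_tabExcessRisk hcl.regQ _ _ _ _ _, min_mul_le hC0 (hsrc.trans ?_)
      (htarget.trans ?_), (min_boundary_le hC₃0 ?_ (hcl.boundaryRisk_le hcb hnP1) ha hT).trans ?_⟩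
    · gcongr
      exact (le_max_right _ _).trans (le_max_left _ _)
    · gcongr
      exact (le_max_left _ _).trans (le_max_left _ _)
    -- The second bound is weaker because `βP / γ ≤ β` in this regime.
    · refine Real.rpow_le_rpow_of_exponent_le hnP1' (neg_le_neg ?_)
      gcongr
      rw [div_le_iff₀ hγ]
      nlinarith
    · refine mul_le_mul_of_nonneg_right (le_max_right _ _) (le_min ?_ hT)
      positivity
  · have hβP : 0 < p.βP := lt_of_le_of_lt (by positivity) hreg
    rcases hβ0.eq_or_lt with hβ | hβ
    · obtain ⟨N, hN⟩ := hvac hβ.symm K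
      exact ⟨1, one_pos, N, fun nQ nP _ _ hnQ _ hcond => absurd hcond (hN nQ hnQ nP)⟩
    -- This exponent is larger than the one in the sample size condition, since `γβ < βP`; the
    -- freedom in `e` is essential here.
    obtain ⟨C₁, hC₁, hev₁⟩ := exists_target_bounds hd p hcQ hβ hK hcτ hCτ
      (show 0 ≤ p.βP * (1 + p.α) / p.γ / (2 * p.βP + d) by positivity)
    obtain ⟨C₂, hC₂, hev₂⟩ := exists_source_bound hd p hcP hβP hC₁
    obtain ⟨N₁, hN₁⟩ := eventually_atTop.1 hev₁
    obtain ⟨N₂, hN₂⟩ := eventually_atTop.1 hev₂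
    refine ⟨max C₁ C₂, by positivity, max 1 (max N₁ N₂), ?_⟩
    rintro nQ nP kQ kP hnQ hnP hcond rfl rfl τ hτ1 hτ2 Q P ηQ ηP hcl
    have hnQ1 : 0 < nQ := lt_of_lt_of_le one_pos ((le_max_left _ _).trans hnQ)
    have hnP1 : 0 < nP := lt_of_lt_of_le one_pos ((le_max_left _ _).trans hnP)
    obtain ⟨hτ, hdev, htarget⟩ := hN₁ nQ (((le_max_left _ _).trans (le_max_right _ _)).trans hnQ)
      nP (numNeighbors d cP p.βP nP) hnP1 hcond τ hτ1 hτ2 ε Q P ηQ ηP hcl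
    have hsrc := hN₂ nP (((le_max_right _ _).trans (le_max_right _ _)).trans hnP) ε nQ
      (numNeighbors d cQ p.β nQ) τ Q P ηQ ηP hτ.le hcl hdev
    have hT := targetRate_nonneg (d := d) p (nP := nP) hnQ1
    have ha := hcl.ambiguityAt_nonneg hτ.le
    have := hcl.probQ
    have := hcl.probP
    refine ⟨integrable_tabExcessRisk hcl.regQ _ _ _ _ _, min_mul_le (by positivity)
      (hsrc.trans ?_) (htarget.trans ?_)⟩
    · gcongr
      exact le_max_right _ _
    · gcongr
      exact le_max_left _ _
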